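/- Let $d\ge 1$ and let $X=(X_t)_{t\ge 0}$ be an isotropic L\'evy process in $\mathbb{R}^d$ (a L\'evy process such that the law of each $X_t$ is invariant under orthogonal transformations) with characteristic exponent $\xi\mapsto\psi(|\xi|)$, that is, $\mathbb{E}[e^{i\xi\cdot X_t}]=e^{-t\psi(|\xi|)}$ for all $t\ge 0$ and $\xi\in\mathbb{R}^d$. For $\lambda>0$ put $$\phi(\lambda)=(4\pi)^{-d/2}\int_{\mathbb{R}^d}e^{-|\xi|^2/4}\,\psi(|\xi|\sqrt{\lambda})\,d\xi,\qquad H(\lambda)=\phi(\lambda)-\lambda\phi'(\lambda).$$ A function $\ell:(0,\infty)\to(0,\infty)$ is said to vary regularly at $0$ (at $\infty$, respectively) with index $\alpha$ if $\ell(c\lambda)/\ell(\lambda)\to c^{\alpha}$ as $\lambda\to 0$ ($\lambda\to\infty$, respectively) for every $c>0$. Let $\gamma\in[0,2)$ and $\gamma_1\in[0,2]$. Assume that $H$ varies regularly at $0$ (at $\infty$, respectively) with index $\gamma$ and that $\psi$ varies regularly at $0$ (at $\infty$, respectively) with index $\gamma_1$; in particular both are positive on $(0,\infty)$. Then $$\mathbb{P}(|X_t|\ge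 r)\sim\frac{1}{\Gamma(2-\gamma)}\,t\,H(r^{-2})\qquad\text{as } r\to\infty\ (r\to 0,\text{ respectively})\text{ and } \frac{t\,\psi(r^{-1})^2}{H(r^{-2})}\to 0,$$ where this means that the quotient of the two sides, as a function of $(t,r)\in(0,\infty)^2$, tends to $1$ in the joint limit: for every $\varepsilon>0$ there are $\delta>0$ and $R>0$ such that the quotient differs from $1$ by less than $\varepsilon$ for all $t>0$ and all $r>R$ ($0<r<R$, respectively) with $t\psi(r^{-1})^2/H(r^{-2})<\delta$. -/

import Mathlib

open MeasureTheory ProbabilityTheory Filter Topology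
open scoped NNReal

noncomputable section

/-- `X` is a Lévy process in `E` under `P`: it starts at `0` almost surely, has independent and
stationary increments, and is continuous in probability. -/
structure IsLevyProcess {Ω E : Type*} [MeasurableSpace Ω] [NormedAddCommGroup E]
    [MeasurableSpace E] (P : Measure Ω) (X : ℝ≥0 → Ω → E) : Prop where
  measurable : ∀ t, Measurable (X t)
  start_zero : ∀ᵐ ω ∂P, X 0 ω = 0
  indep_increments : HasIndepIncrements X P
  stationary_increments : ∀ s t : ℝ≥0,
    P.map (fun ω => X (s + t) ω - X s ω) = P.map (X t)
  continuous_in_probability : ∀ s : ℝ≥0, TendstoInMeasure P X (𝓝 s) (X s)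

/-- An isotropic Lévy process: the law of each `X t` is invariant under all linear isometries. -/
structure IsIsotropicLevyProcess {Ω : Type*} [MeasurableSpace Ω] {d : ℕ} (P : Measure Ω)
    (X : ℝ≥0 → Ω → EuclideanSpace ℝ (Fin d)) : Prop extends IsLevyProcess P X where
  isotropic : ∀ (t : ℝ≥0) (O : EuclideanSpace ℝ (Fin d) ≃ₗᵢ[ℝ] EuclideanSpace ℝ (Fin d)),
    P.map (fun ω => O (X t ω)) = P.map (X t)

/-- `ξ ↦ ψ ‖ξ‖` is the characteristic exponent of `X`: `E[exp(i ξ·X_t)] = exp(-t ψ(‖ξ‖))`. -/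
def HasRadialCharExponent {Ω : Type*} [MeasurableSpace Ω] {d : ℕ} (P : Measure Ω)
    (X : ℝ≥0 → Ω → EuclideanSpace ℝ (Fin d)) (ψ : ℝ → ℝ) : Prop :=
  ∀ (t : ℝ≥0) (ξ : EuclideanSpace ℝ (Fin d)),
    charFun (P.map (X t)) ξ = Complex.exp (-((t : ℝ) * ψ ‖ξ‖ : ℝ))

/-- Regular variation with index `α` along `l` of a positive function on `(0, ∞)`; here `l` is
`𝓝[>] 0` (regular variation at `0`) or `atTop` (regular variation at `∞`). -/
def RegularlyVaries (l : Filter ℝ) (f : ℝ → ℝ) (α : ℝ) : Prop :=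
  (∀ x : ℝ, 0 < x → 0 < f x) ∧
    ∀ c : ℝ, 0 < c → Tendsto (fun x => f (c * x) / f x) l (𝓝 (c ^ α))

/-- The auxiliary function
`φ(x) = (4π)^{-d/2} ∫_{ℝ^d} exp(-‖ξ‖²/4) ψ(‖ξ‖ √x) dξ`. -/
def auxPhi (d : ℕ) (ψ : ℝ → ℝ) (x : ℝ) : ℝ :=
  (4 * Real.pi) ^ (-(d : ℝ) / 2) *
    ∫ ξ : EuclideanSpace ℝ (Fin d), Real.exp (-‖ξ‖ ^ 2 / 4) * ψ (‖ξ‖ * √x)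

/-- `H(x) = φ(x) - x φ'(x)`. -/
def auxH (d : ℕ) (ψ : ℝ → ℝ) (x : ℝ) : ℝ :=
  auxPhi d ψ x - x * deriv (auxPhi d ψ) x

/-- The filter on pairs `(t, r)`, `t > 0`, `r > 0`, describing the joint limit
"`r` tends along `l` and `h(t, r) → 0`". -/
def jointLimit (l : Filter ℝ) (h : ℝ≥0 → ℝ → ℝ) : Filter (ℝ≥0 × ℝ) :=
  comap Prod.snd l ⊓ comap (fun p => h p.1 p.2) (𝓝 0) ⊓ 𝓟 {p | 0 < p.1 ∧ 0 < p.2}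

/-- `f(t, r) ∼ g(t, r)` as `r` tends along `l` and `h(t, r) → 0`: the quotient tends to `1`. -/
def JointlyAsymptotic (l : Filter ℝ) (h f g : ℝ≥0 → ℝ → ℝ) : Prop :=
  Tendsto (fun p : ℝ≥0 × ℝ => f p.1 p.2 / g p.1 p.2) (jointLimit l h) (𝓝 1)

end

/-! Write the tail through its Laplace functional. For `Y = |X_t|²/r²`, the layer-cake formula turns
`∫ e^{-xu} u P(Y ≥ u) du` into `x⁻² E[1 - e^{-xY}(1 + xY)]`. This expectation is the operator `1 - x
d/dx` applied to `1 - E e^{-xY}`, the same operator that produces `H` from `φ`. Gaussian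
subordination expresses `E e^{-x|X_t|²}` as the Gaussian average of `e^{-tψ(|ξ|√x)}`, so replacing
`1 - e^{-tψ}` by `tψ` replaces the expectation by `tH` (`integral_one_sub_exp_sub_auxH`).

The replacement costs at most a Gaussian average of `t²ψ(|ξ|y)²`, where `y = √x`. This is
`O(t²ψ(y)²)`: a Potter bound controls `ψ(|ξ|y)/ψ(y)` for small `|ξ|`, and `ψ(2s) ≤ 4ψ(s)` gives
quadratic growth for large `|ξ|`. Relative to `tH` the error is of order `tψ²/H`, exactly the
quantity assumed to vanish (`exists_eventually_abs_integral_sub_auxH_le`).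

Regular variation of `H` then makes the Laplace transforms of `u P(Y ≥ u)/(tH(r⁻²))` converge to
`x^{γ-2}`, the transform of `u^{1-γ}/Γ(2-γ)`. The tail is monotone in `u`, so a Karamata-type
argument gives convergence at `u = 1`, which is the claim (`tendsto_one_of_tendsto_laplace`). The
factor `u` keeps the limit density integrable at `0` for all `γ < 2`. Nothing depends on the filter,
so the joint limit in `(t, r)` is handled directly. -/

/-! ### Potter bounds and quadratic growth -/

/-- Dilation-boundedness of a continuous positive function is locally uniform in the dilation. -/
theorem exists_eventually_forall_dilation_le {l : Filter ℝ} [l.IsCountablyGenerated] {f : ℝ → ℝ}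
    (hf : ContinuousOn f (Set.Ioi 0)) (hpos : ∀ x, 0 < x → 0 < f x)
    (hl : ∀ᶠ x in l, 0 < x) (hscale : ∀ c : ℝ, 0 < c → Tendsto (fun x => c * x) l l)
    (hb : ∀ c : ℝ, 0 < c → ∃ K, ∀ᶠ x in l, f (c * x) ≤ K * f x) {s : Set ℝ} (hs : IsCompact s) :
    ∃ K, ∀ᶠ x in l, ∀ y ∈ s, f (Real.exp y * x) ≤ K * f x := by
  obtain ⟨S, hS⟩ := l.exists_antitone_basis
  let A : ℕ → Set ℝ := fun n => {y | ∀ x ∈ S n, 0 < x → f (Real.exp y * x) ≤ n * f x}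
  have hA : ∀ n, IsClosed (A n) := by
    intro n
    simp only [A, Set.ofPred_forall]
    refine isClosed_iInter fun x => isClosed_iInter fun _ => isClosed_iInter fun hx => ?_
    refine isClosed_le (hf.comp_continuous (by fun_prop) fun y => ?_) continuous_const
    exact mul_pos (Real.exp_pos y) hx
  have hU : ⋃ n, A n = Set.univ := by
    refine Set.eq_univ_of_forall fun y => ?_
    obtain ⟨K, hK⟩ := hb (Real.exp y) (Real.exp_pos y)
    obtain ⟨m, -, hm⟩ := hS.1.mem_iff.1 hK
    obtain ⟨k, hk⟩ := exists_nat_ge K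
    refine Set.mem_iUnion.2 ⟨max m k, fun x hx h0 => ?_⟩
    refine (hm (hS.2 (le_max_left m k) hx) : f (Real.exp y * x) ≤ K * f x).trans ?_
    have : K ≤ (max m k : ℕ) := hk.trans (by exact_mod_cast le_max_right m k)
    exact mul_le_mul_of_nonneg_right this (hpos x h0).le
  -- Baire category: in the logarithmic variable some `A n` contains a neighbourhood of a point
  -- `y₀`. One further fixed dilation, by `exp (z - y₀)`, carries this bound to a neighbourhood of
  -- any `z`, and compactness finishes.
  obtain ⟨n, y₀, hy₀⟩ := nonempty_interior_of_iUnion_of_closed hA hU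
  have hnhds : A n ∈ 𝓝 y₀ := mem_interior_iff_mem_nhds.1 hy₀
  refine hs.induction_on (p := fun s => ∃ K, ∀ᶠ x in l, ∀ y ∈ s, f (Real.exp y * x) ≤ K * f x)
    ⟨0, by simp⟩ ?_ ?_ ?_
  · rintro s t hst ⟨K, hK⟩
    exact ⟨K, hK.mono fun x hx y hy => hx y (hst hy)⟩
  · rintro s t ⟨K, hK⟩ ⟨K', hK'⟩
    refine ⟨max K K', ?_⟩
    filter_upwards [hK, hK', hl] with x h1 h2 h0 y hy
    rcases hy with hy | hy
    · exact (h1 y hy).trans (mul_le_mul_of_nonneg_right (le_max_left _ _) (hpos x h0).le)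
    · exact (h2 y hy).trans (mul_le_mul_of_nonneg_right (le_max_right _ _) (hpos x h0).le)
  · intro z _
    refine ⟨(fun y => y - z + y₀) ⁻¹' A n, mem_nhdsWithin_of_mem_nhds ?_, ?_⟩
    · have : Tendsto (fun y => y - z + y₀) (𝓝 z) (𝓝 (z - z + y₀)) :=
        Continuous.tendsto (by fun_prop) z
      rw [sub_self, zero_add] at this
      exact this hnhds
    · obtain ⟨K, hK⟩ := hb (Real.exp (z - y₀)) (Real.exp_pos _)
      refine ⟨n * K, ?_⟩
      filter_upwards [hK, hl, hscale _ (Real.exp_pos (z - y₀)) (hS.1.mem_of_mem (i := n) trivial)]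
        with x h1 h0 hmem y hy
      have h2 := hy (Real.exp (z - y₀) * x) hmem (mul_pos (Real.exp_pos _) h0)
      have h3 : Real.exp (y - z + y₀) * (Real.exp (z - y₀) * x) = Real.exp y * x := by
        rw [← mul_assoc, ← Real.exp_add]; ring_nf
      rw [h3] at h2
      calc f (Real.exp y * x) ≤ n * f (Real.exp (z - y₀) * x) := h2
        _ ≤ n * (K * f x) := by gcongr
        _ = n * K * f x := by ring

/-- Convergence of the dilation quotients bounds each of them eventually; the Baire argument makes
the bound uniform because the logarithms of `[1/2, 1]` form a compact interval. -/
theorem exists_eventually_forall_half_one_le {l : Filter ℝ} [l.IsCountablyGenerated] {f : ℝ → ℝ}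
    (hf : ContinuousOn f (Set.Ioi 0)) (hl : ∀ᶠ x in l, 0 < x)
    (hscale : ∀ c : ℝ, 0 < c → Tendsto (fun x => c * x) l l) {α : ℝ}
    (hreg : RegularlyVaries l f α) :
    ∃ K, ∀ᶠ x in l, ∀ v ∈ Set.Icc (1 / 2 : ℝ) 1, f (v * x) ≤ K * f x := by
  have hb : ∀ c : ℝ, 0 < c → ∃ K, ∀ᶠ x in l, f (c * x) ≤ K * f x := by
    intro c hc
    refine ⟨c ^ α + 1, ?_⟩
    filter_upwards [hl, (hreg.2 c hc).eventually_lt_const (lt_add_one _)] with x h0 hx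
    exact ((div_lt_iff₀ (hreg.1 x h0)).1 hx).le
  obtain ⟨K, hK⟩ := exists_eventually_forall_dilation_le hf hreg.1 hl hscale hb
    (isCompact_Icc (a := Real.log (1 / 2)) (b := 0))
  refine ⟨K, hK.mono fun x hx v hv => ?_⟩
  have hv0 : 0 < v := by linarith [hv.1]
  have := hx (Real.log v) ⟨Real.log_le_log (by norm_num) hv.1, Real.log_nonpos hv0.le hv.2⟩
  rwa [Real.exp_log hv0] at this

/-- Potter-type bound: iterate a one-step halving estimate inside an order-connected set. -/
theorem le_mul_rpow_of_halving {f : ℝ → ℝ} {S : Set ℝ} (hS : S.OrdConnected) (hS0 : S ⊆ Set.Ioi 0)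
    {K δ : ℝ} (hK : 0 ≤ K) (hδ : 0 ≤ δ) (hpos : ∀ x, 0 < x → 0 < f x)
    (h1 : ∀ x ∈ S, ∀ v ∈ Set.Icc (1 / 2 : ℝ) 1, f (v * x) ≤ K * f x)
    (h2 : ∀ x ∈ S, f (1 / 2 * x) ≤ 2 ^ δ * f x) {x u : ℝ} (hx : x ∈ S) (hu0 : 0 < u) (hu1 : u ≤ 1)
    (hux : u * x ∈ S) : f (u * x) ≤ K * u ^ (-δ) * f x := by
  have key : ∀ n : ℕ, ∀ x ∈ S, ∀ u : ℝ, (1 / 2 : ℝ) ^ (n + 1) ≤ u → u ≤ 1 → u * x ∈ S →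
      f (u * x) ≤ K * u ^ (-δ) * f x := by
    intro n
    induction n with
    | zero =>
      intro x hx u hu hu1 _
      refine (h1 x hx u ⟨by simpa using hu, hu1⟩).trans ?_
      have hu0 : 0 < u := lt_of_lt_of_le (by norm_num) hu
      have : 1 ≤ u ^ (-δ) := Real.one_le_rpow_of_pos_of_le_one_of_nonpos hu0 hu1 (by linarith)
      have hfx := hpos x (hS0 hx)
      exact mul_le_mul_of_nonneg_right (le_mul_of_one_le_right hK this) hfx.le
    | succ n ih =>
      intro x hx u hu hu1 hux
      have hu0 : 0 < u := lt_of_lt_of_le (by positivity) hu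
      have hx0 : 0 < x := hS0 hx
      rcases le_or_gt ((1 / 2 : ℝ) ^ (n + 1)) u with h | h
      · exact ih x hx u h hu1 hux
      · have hu2 : u ≤ 1 / 2 := h.le.trans (by
          rw [pow_succ]
          have : (1 / 2 : ℝ) ^ n ≤ 1 := pow_le_one₀ (by norm_num) (by norm_num)
          linarith)
        have hmem : 1 / 2 * x ∈ S := hS.out hux hx ⟨by gcongr, by linarith⟩
        have h3 := ih (1 / 2 * x) hmem (2 * u) (by rw [pow_succ] at hu; linarith) (by linarith)
          (by convert hux using 1; ring)
        rw [show 2 * u * (1 / 2 * x) = u * x by ring] at h3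
        refine h3.trans ?_
        have h4 := h2 x hx
        rw [Real.mul_rpow (by norm_num) hu0.le]
        calc K * (2 ^ (-δ) * u ^ (-δ)) * f (1 / 2 * x)
            ≤ K * (2 ^ (-δ) * u ^ (-δ)) * (2 ^ δ * f x) := by gcongr
          _ = K * u ^ (-δ) * f x * (2 ^ (-δ) * 2 ^ δ) := by ring
          _ = K * u ^ (-δ) * f x := by
            rw [← Real.rpow_add (by norm_num)]; simp
  obtain ⟨n, hn⟩ := exists_pow_lt_of_lt_one hu0 (by norm_num : (1 / 2 : ℝ) < 1)
  refine key n x hx u (le_trans ?_ hn.le) hu1 hux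
  exact pow_le_pow_of_le_one (by norm_num) (by norm_num) (Nat.le_succ n)

/-- The limit `(1/2)^α` is at most `1` since `α ≥ 0`, hence strictly below `2 ^ δ`. -/
theorem RegularlyVaries.eventually_halving {l : Filter ℝ} {f : ℝ → ℝ} {α δ : ℝ}
    (hreg : RegularlyVaries l f α) (hl : ∀ᶠ x in l, 0 < x) (hα : 0 ≤ α) (hδ : 0 < δ) :
    ∀ᶠ x in l, f (1 / 2 * x) ≤ 2 ^ δ * f x := by
  have h : ((1 / 2 : ℝ)) ^ α < 2 ^ δ :=
    (Real.rpow_le_one (by norm_num) (by norm_num) hα).trans_lt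
      (Real.one_lt_rpow (by norm_num) hδ)
  filter_upwards [hl, (hreg.2 (1 / 2) (by norm_num)).eventually_lt_const h] with x h0 hx
  exact ((div_lt_iff₀ (hreg.1 x h0)).1 hx).le

theorem tendsto_const_mul_nhdsGT_zero {c : ℝ} (hc : 0 < c) :
    Tendsto (fun x : ℝ => c * x) (𝓝[>] 0) (𝓝[>] 0) := by
  refine tendsto_nhdsWithin_iff.2 ⟨?_, ?_⟩
  · have : Tendsto (fun x : ℝ => c * x) (𝓝 0) (𝓝 (c * 0)) := Continuous.tendsto (by fun_prop) 0
    rw [mul_zero] at this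
    exact this.mono_left nhdsWithin_le_nhds
  · filter_upwards [self_mem_nhdsWithin] with x hx
    exact mul_pos hc hx

/-- An interval `(0, x₀]` is stable under contractions, so the halving iteration never leaves the
region where the one-step bounds hold. -/
theorem RegularlyVaries.potter_zero {f : ℝ → ℝ} {α δ : ℝ} (hf : ContinuousOn f (Set.Ioi 0))
    (hreg : RegularlyVaries (𝓝[>] 0) f α) (hα : 0 ≤ α) (hδ : 0 < δ) :
    ∃ K, ∀ᶠ x in 𝓝[>] 0, ∀ u, 0 < u → u ≤ 1 → f (u * x) ≤ K * u ^ (-δ) * f x := by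
  have hl : ∀ᶠ x : ℝ in 𝓝[>] 0, 0 < x := self_mem_nhdsWithin
  obtain ⟨K, hK⟩ := exists_eventually_forall_half_one_le hf hl
    (fun c hc => tendsto_const_mul_nhdsGT_zero hc) hreg
  obtain ⟨x₀, hx₀, hS⟩ := mem_nhdsGT_iff_exists_Ioc_subset.1
    (hK.and (hreg.eventually_halving hl hα hδ))
  refine ⟨max K 0, ?_⟩
  filter_upwards [Ioc_mem_nhdsGT hx₀] with x hx u hu0 hu1
  refine le_mul_rpow_of_halving (S := Set.Ioc 0 x₀) Set.ordConnected_Ioc (fun y hy => hy.1)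
    (le_max_right _ _) hδ.le hreg.1 ?_ (fun y hy => (hS hy).2) hx hu0 hu1
    ⟨mul_pos hu0 hx.1, (mul_le_of_le_one_left hx.1.le hu1).trans hx.2⟩
  intro y hy v hv
  exact ((hS hy).1 v hv).trans
    (mul_le_mul_of_nonneg_right (le_max_left _ _) (hreg.1 y hy.1).le)

/-- Here a contraction may leave `[x₀, ∞)`. Below `x₀` the function is bounded by continuity on `[0,
x₀]`, and `f x₀` is compared with `f x` by the iteration; `u x < x₀` gives `(x₀/x)^(-δ) ≤ u^(-δ)`.
-/
theorem RegularlyVaries.potter_atTop {f : ℝ → ℝ} {α δ : ℝ} (hf : ContinuousOn f (Set.Ici 0))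
    (hreg : RegularlyVaries atTop f α) (hα : 0 ≤ α) (hδ : 0 < δ) :
    ∃ K, ∀ᶠ x in atTop, ∀ u, 0 < u → u ≤ 1 → f (u * x) ≤ K * u ^ (-δ) * f x := by
  have hl : ∀ᶠ x : ℝ in atTop, 0 < x := eventually_gt_atTop 0
  obtain ⟨K, hK⟩ := exists_eventually_forall_half_one_le (hf.mono Set.Ioi_subset_Ici_self) hl
    (fun c hc => tendsto_id.const_mul_atTop hc) hreg
  obtain ⟨a, ha⟩ := eventually_atTop.1 (hK.and (hreg.eventually_halving hl hα hδ))
  set x₀ := max a 1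
  have hx₀ : 0 < x₀ := lt_of_lt_of_le one_pos (le_max_right _ _)
  have hS : ∀ x ∈ Set.Ici x₀, ∀ u : ℝ, 0 < u → u ≤ 1 → u * x ∈ Set.Ici x₀ →
      f (u * x) ≤ max K 0 * u ^ (-δ) * f x := by
    intro x hx u hu0 hu1 hux
    refine le_mul_rpow_of_halving Set.ordConnected_Ici (fun y hy => hx₀.trans_le hy)
      (le_max_right _ _) hδ.le hreg.1 ?_
      (fun y hy => (ha y ((le_max_left _ _).trans hy)).2) hx hu0 hu1 hux
    intro y hy v hv
    exact ((ha y ((le_max_left _ _).trans hy)).1 v hv).trans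
      (mul_le_mul_of_nonneg_right (le_max_left _ _) (hreg.1 y (hx₀.trans_le hy)).le)
  obtain ⟨M, hM⟩ := (isCompact_Icc (a := (0 : ℝ)) (b := x₀)).exists_bound_of_continuousOn
    (hf.mono Set.Icc_subset_Ici_self)
  have hM0 : 0 ≤ M := (norm_nonneg _).trans (hM x₀ ⟨hx₀.le, le_rfl⟩)
  have hf0 := hreg.1 x₀ hx₀
  refine ⟨max (max K 0) (M / f x₀ * max K 0), ?_⟩
  filter_upwards [eventually_ge_atTop x₀] with x hx u hu0 hu1
  have hx0 : 0 < x := hx₀.trans_le hx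
  have hfx := hreg.1 x hx0
  rcases le_or_gt x₀ (u * x) with h | h
  · refine (hS x hx u hu0 hu1 h).trans ?_
    gcongr ?_ * u ^ (-δ) * f x
    exact le_max_left _ _
  · have h1 := hS x hx (x₀ / x) (by positivity) ((div_le_one hx0).2 hx)
      (by simp [div_mul_cancel₀ _ hx0.ne'])
    rw [div_mul_cancel₀ _ hx0.ne'] at h1
    have h2 : (x₀ / x) ^ (-δ) ≤ u ^ (-δ) :=
      Real.rpow_le_rpow_of_nonpos hu0 ((le_div_iff₀ hx0).2 h.le) (by linarith)
    calc f (u * x) ≤ M := (le_abs_self _).trans (hM _ ⟨by positivity, h.le⟩)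
      _ = M / f x₀ * f x₀ := by field_simp
      _ ≤ M / f x₀ * (max K 0 * (x₀ / x) ^ (-δ) * f x) := by gcongr
      _ ≤ M / f x₀ * (max K 0 * u ^ (-δ) * f x) := by gcongr
      _ = M / f x₀ * max K 0 * u ^ (-δ) * f x := by ring
      _ ≤ _ := by
        gcongr ?_ * u ^ (-δ) * f x
        exact le_max_right _ _

/-- Quadratic growth from the doubling estimate `f (2 s) ≤ 4 f s`. -/
theorem le_quadratic_of_doubling {f : ℝ → ℝ} (h2 : ∀ s, 0 ≤ s → f (2 * s) ≤ 4 * f s) {x K : ℝ}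
    (hK : 0 ≤ K) (hx : 0 ≤ x) (h1 : ∀ v ∈ Set.Icc (1 / 2 : ℝ) 1, f (v * x) ≤ K) {u : ℝ}
    (hu : 1 / 2 ≤ u) : f (u * x) ≤ 4 * u ^ 2 * K := by
  have key : ∀ n : ℕ, ∀ u : ℝ, 1 / 2 ≤ u → u ≤ 2 ^ n → f (u * x) ≤ 4 * u ^ 2 * K := by
    intro n
    induction n with
    | zero =>
      intro u hu hu1
      refine (h1 u ⟨hu, by simpa using hu1⟩).trans (le_mul_of_one_le_left hK ?_)
      nlinarith
    | succ n ih =>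
      intro u hu hun
      rcases le_or_gt u (2 ^ n) with h | h
      · exact ih u hu h
      · have h1n : (1 : ℝ) ≤ 2 ^ n := one_le_pow₀ (by norm_num)
        have h3 := ih (u / 2) (by linarith) (by rw [pow_succ] at hun; linarith)
        have h4 := h2 (u / 2 * x) (by positivity)
        rw [show 2 * (u / 2 * x) = u * x by ring] at h4
        nlinarith
  obtain ⟨n, hn⟩ := pow_unbounded_of_one_lt u (by norm_num : (1 : ℝ) < 2)
  exact key n u hu hn.le

/-- Two-sided control of a doubling function under a Potter bound on `(0, 1]`. -/
theorem exists_eventually_le_potter_add_sq {f : ℝ → ℝ} {l : Filter ℝ} {δ : ℝ} (hδ : 0 < δ)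
    (hl : ∀ᶠ x in l, 0 < x) (hpos : ∀ x, 0 < x → 0 < f x)
    (h2 : ∀ s, 0 ≤ s → f (2 * s) ≤ 4 * f s)
    (hP : ∃ K, ∀ᶠ x in l, ∀ u, 0 < u → u ≤ 1 → f (u * x) ≤ K * u ^ (-δ) * f x) :
    ∃ K, 0 ≤ K ∧ ∀ᶠ x in l, ∀ u, 0 < u → f (u * x) ≤ K * (u ^ (-δ) + u ^ 2) * f x := by
  obtain ⟨K, hK⟩ := hP
  set K' := max K 0
  have hK' : 0 ≤ K' := le_max_right _ _
  have h12 : (1 : ℝ) ≤ (1 / 2) ^ (-δ) :=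
    Real.one_le_rpow_of_pos_of_le_one_of_nonpos (by norm_num) (by norm_num) (by linarith)
  refine ⟨4 * K' * (1 / 2) ^ (-δ), by positivity, ?_⟩
  filter_upwards [hl, hK] with x hx hxK u hu
  have hfx := hpos x hx
  have hK1 : ∀ u, 0 < u → u ≤ 1 → f (u * x) ≤ K' * u ^ (-δ) * f x := fun u h0 h1 =>
    (hxK u h0 h1).trans (by gcongr; exact le_max_left _ _)
  rcases le_or_gt u 1 with h | h
  · refine (hK1 u hu h).trans ?_
    gcongr
    · nlinarith
    · nlinarith [sq_nonneg u]
  · have h3 := le_quadratic_of_doubling h2 (x := x) (K := K' * (1 / 2) ^ (-δ) * f x)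
      (by positivity) hx.le (fun v hv => by
        have hv0 : 0 < v := by linarith [hv.1]
        refine (hK1 v hv0 hv.2).trans ?_
        gcongr K' * ?_ * f x
        exact Real.rpow_le_rpow_of_nonpos (by norm_num) hv.1 (by linarith))
      (u := u) (by linarith)
    refine h3.trans ?_
    have : 0 ≤ u ^ (-δ) := by positivity
    calc 4 * u ^ 2 * (K' * (1 / 2) ^ (-δ) * f x) = 4 * K' * (1 / 2) ^ (-δ) * u ^ 2 * f x := by ring
      _ ≤ _ := by gcongr; linarith

/-! ### Karamata's Tauberian argument -/

/-- Uniform approximation: convergence of functionals `F ↦ ∫ F(e^{-u}) dm` on monomials passes to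
continuous functions. -/
theorem tendsto_integral_comp_exp_neg {ι : Type*} {l : Filter ι} {m : ι → ℝ → ℝ} {m₀ : ℝ → ℝ}
    (hm : ∀ᶠ p in l, (∀ u ∈ Set.Ioi (0 : ℝ), 0 ≤ m p u) ∧ IntegrableOn (m p) (Set.Ioi 0))
    (hm₀ : ∀ u ∈ Set.Ioi (0 : ℝ), 0 ≤ m₀ u) (hm₀i : IntegrableOn m₀ (Set.Ioi 0))
    (h : ∀ n : ℕ, Tendsto (fun p => ∫ u in Set.Ioi (0 : ℝ), Real.exp (-u) ^ n * m p u) l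
      (𝓝 (∫ u in Set.Ioi (0 : ℝ), Real.exp (-u) ^ n * m₀ u)))
    {f : ℝ → ℝ} (hf : Continuous f) :
    Tendsto (fun p => ∫ u in Set.Ioi (0 : ℝ), f (Real.exp (-u)) * m p u) l
      (𝓝 (∫ u in Set.Ioi (0 : ℝ), f (Real.exp (-u)) * m₀ u)) := by
  have hint : ∀ {g w : ℝ → ℝ}, Continuous g → IntegrableOn w (Set.Ioi 0) →
      IntegrableOn (fun u => g (Real.exp (-u)) * w u) (Set.Ioi 0) := by
    intro g w hg hw
    obtain ⟨C, hC⟩ := (isCompact_Icc (a := (0 : ℝ)) (b := 1)).exists_bound_of_continuousOn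
      hg.continuousOn
    refine Integrable.bdd_mul (c := C) hw (by fun_prop) ?_
    filter_upwards [ae_restrict_mem measurableSet_Ioi] with u hu
    exact hC _ ⟨(Real.exp_pos _).le, Real.exp_le_one_iff.2 (by linarith [Set.mem_Ioi.1 hu])⟩
  have hpoly : ∀ Q : Polynomial ℝ,
      Tendsto (fun p => ∫ u in Set.Ioi (0 : ℝ), Q.eval (Real.exp (-u)) * m p u) l
        (𝓝 (∫ u in Set.Ioi (0 : ℝ), Q.eval (Real.exp (-u)) * m₀ u)) := by
    intro Q
    have hsum : ∀ w : ℝ → ℝ, IntegrableOn w (Set.Ioi 0) →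
        ∫ u in Set.Ioi (0 : ℝ), Q.eval (Real.exp (-u)) * w u =
          ∑ i ∈ Finset.range (Q.natDegree + 1),
            Q.coeff i * ∫ u in Set.Ioi (0 : ℝ), Real.exp (-u) ^ i * w u := by
      intro w hw
      simp_rw [Polynomial.eval_eq_sum_range, Finset.sum_mul, mul_assoc]
      rw [integral_finsetSum]
      · simp_rw [integral_const_mul]
      · intro i _
        exact (hint (g := fun y => y ^ i) (by fun_prop) hw).const_mul _
    rw [hsum _ hm₀i]
    refine (tendsto_finsetSum _ fun i _ => (h i).const_mul (Q.coeff i)).congr' ?_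
    filter_upwards [hm] with p hp
    exact (hsum _ hp.2).symm
  have hclose : ∀ {w : ℝ → ℝ} {Q : Polynomial ℝ} {ε : ℝ}, IntegrableOn w (Set.Ioi 0) →
      (∀ u ∈ Set.Ioi (0 : ℝ), 0 ≤ w u) → (∀ y ∈ Set.Icc (0 : ℝ) 1, |Q.eval y - f y| < ε) →
      |(∫ u in Set.Ioi (0 : ℝ), Q.eval (Real.exp (-u)) * w u) -
        ∫ u in Set.Ioi (0 : ℝ), f (Real.exp (-u)) * w u| ≤ ε * ∫ u in Set.Ioi (0 : ℝ), w u := by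
    intro w Q ε hw hw0 hQ
    rw [← integral_sub (hint (g := fun y => Q.eval y) Q.continuous hw) (hint hf hw),
      ← integral_const_mul, ← Real.norm_eq_abs]
    refine norm_integral_le_of_norm_le (hw.const_mul ε) ?_
    filter_upwards [ae_restrict_mem measurableSet_Ioi] with u hu
    rw [← sub_mul, norm_mul, Real.norm_of_nonneg (hw0 u hu)]
    refine mul_le_mul_of_nonneg_right (hQ _ ⟨(Real.exp_pos _).le, ?_⟩).le (hw0 u hu)
    exact Real.exp_le_one_iff.2 (by linarith [Set.mem_Ioi.1 hu])
  set T := ∫ u in Set.Ioi (0 : ℝ), m₀ u with hT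
  have hT0 : 0 ≤ T := setIntegral_nonneg measurableSet_Ioi hm₀
  have hmass : Tendsto (fun p => ∫ u in Set.Ioi (0 : ℝ), m p u) l (𝓝 T) := by
    simpa using h 0
  rw [Metric.tendsto_nhds]
  intro ε hε
  -- The masses of `m p` are eventually below `T + 1`, and `m₀` has mass `T`, so this tolerance
  -- makes each of the two replacements of `f` by `Q` cost at most `ε / 3`.
  obtain ⟨Q, hQ⟩ := exists_polynomial_near_of_continuousOn 0 1 f hf.continuousOn
    (ε / (3 * (T + 1))) (by positivity)
  filter_upwards [hm, hmass.eventually_lt_const (lt_add_one T),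
    Metric.tendsto_nhds.1 (hpoly Q) (ε / 3) (by positivity)] with p hp hp1 hp2
  have e1 := hclose hp.2 hp.1 hQ
  have e2 := hclose hm₀i hm₀ hQ
  rw [Real.dist_eq] at hp2 ⊢
  have hb : ∀ y, y ≤ T + 1 → ε / (3 * (T + 1)) * y ≤ ε / 3 := by
    intro y hy
    calc ε / (3 * (T + 1)) * y ≤ ε / (3 * (T + 1)) * (T + 1) := by gcongr
      _ = ε / 3 := by field_simp
  have e3 := e1.trans (hb _ hp1.le)
  have e4 := e2.trans (hb _ (by linarith))
  rw [abs_le] at e3 e4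
  rw [abs_lt] at hp2 ⊢
  constructor <;> linarith [e3.1, e3.2, e4.1, e4.2, hp2.1, hp2.2]

/-- Tauberian theorem with a monotone density, evaluated at the point `1`. -/
theorem tendsto_one_of_tendsto_laplace {ι : Type*} {l : Filter ι} {q : ι → ℝ → ℝ} {β : ℝ}
    (hβ0 : 0 < β) (hβ2 : β ≤ 2)
    (hq : ∀ᶠ p in l, (∀ u, 0 ≤ q p u) ∧ Antitone (q p) ∧
      IntegrableOn (fun u => Real.exp (-u) * u * q p u) (Set.Ioi 0))
    (h : ∀ x : ℝ, 0 < x → Tendsto (fun p => ∫ u in Set.Ioi (0 : ℝ), Real.exp (-(x * u)) * u * q p u)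
      l (𝓝 (x ^ (-β)))) :
    Tendsto (fun p => q p 1) l (𝓝 (1 / Real.Gamma β)) := by
  have hΓ : 0 < Real.Gamma β := Real.Gamma_pos_of_pos hβ0
  -- The function `u^(β-1)/Γ(β)` has Laplace transform `x^(-β)`. The extra `e^{-u}` makes its mass
  -- finite, and the transform at `x = n + 1` becomes the `n`-th moment in the variable `e^{-u}`.
  set m₀ : ℝ → ℝ := fun u => Real.exp (-u) * u * (u ^ (β - 2) / Real.Gamma β) with hm₀def
  have hm₀eq : ∀ u ∈ Set.Ioi (0 : ℝ), ∀ n : ℕ, Real.exp (-u) ^ n * m₀ u =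
      u ^ (β - 1) * Real.exp (-((n + 1 : ℝ) * u)) / Real.Gamma β := by
    intro u hu n
    have h1 : u ^ (β - 1) = u * u ^ (β - 2) := by
      rw [show β - 1 = 1 + (β - 2) by ring, Real.rpow_add (Set.mem_Ioi.1 hu), Real.rpow_one]
    have h2 : Real.exp (-((n + 1 : ℝ) * u)) = Real.exp (-u) ^ n * Real.exp (-u) := by
      rw [← Real.exp_nat_mul, ← Real.exp_add]; ring_nf
    rw [hm₀def, h1, h2]; ring
  have hm₀int : ∀ n : ℕ, ∫ u in Set.Ioi (0 : ℝ), Real.exp (-u) ^ n * m₀ u = (n + 1 : ℝ) ^ (-β) := by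
    intro n
    rw [setIntegral_congr_fun measurableSet_Ioi (fun u hu => hm₀eq u hu n), integral_div,
      Real.integral_rpow_mul_exp_neg_mul_Ioi hβ0 (by positivity), mul_div_cancel_right₀ _ hΓ.ne',
      one_div, Real.inv_rpow (by positivity), Real.rpow_neg (by positivity)]
  have hm₀i : IntegrableOn m₀ (Set.Ioi 0) := by
    refine MeasureTheory.Integrable.of_integral_ne_zero ?_
    have := hm₀int 0
    simp only [pow_zero, one_mul] at this
    rw [this]; simp
  have hm₀nn : ∀ u ∈ Set.Ioi (0 : ℝ), 0 ≤ m₀ u := by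
    intro u hu
    have := Set.mem_Ioi.1 hu
    positivity
  have hlim := fun (f : ℝ → ℝ) (hf : Continuous f) =>
    tendsto_integral_comp_exp_neg (l := l) (m := fun p u => Real.exp (-u) * u * q p u) (m₀ := m₀)
      (hq.mono fun p hp => ⟨fun u hu => mul_nonneg (mul_nonneg (Real.exp_pos _).le
        (Set.mem_Ioi.1 hu).le) (hp.1 u), hp.2.2⟩) hm₀nn hm₀i (by
      intro n
      rw [hm₀int]
      refine (h (n + 1) (by positivity)).congr fun p => ?_
      refine integral_congr_ae (ae_of_all _ fun u => ?_)
      have h2 : Real.exp (-((n + 1 : ℝ) * u)) = Real.exp (-u) ^ n * Real.exp (-u) := by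
        rw [← Real.exp_nat_mul, ← Real.exp_add]; ring_nf
      simp only [h2]; ring) hf
  -- A bump supported on `[x, y]` compares `q` at the end points with the limit.
  have hbump : ∀ x y : ℝ, 0 < x → x < y → ∃ J : ℝ, ∃ I : ι → ℝ, ∃ I₀ : ℝ, 0 < J ∧
      Tendsto I l (𝓝 I₀) ∧ (∀ᶠ p in l, q p y * J ≤ I p ∧ I p ≤ q p x * J) ∧
      y ^ (β - 2) / Real.Gamma β * J ≤ I₀ ∧ I₀ ≤ x ^ (β - 2) / Real.Gamma β * J := by
    intro x y hx hxy
    -- In the variable `z = e^{-u}` the product of the two linear factors is positive exactly for `x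
    -- < u < y`; its positive part is continuous, as the approximation lemma requires.
    set f : ℝ → ℝ := fun z => max 0 ((z - Real.exp (-y)) * (Real.exp (-x) - z)) with hfdef
    have hf : Continuous f := by fun_prop
    have hf0 : ∀ z, 0 ≤ f z := fun z => le_max_left _ _
    have hsupp : ∀ u, u ∉ Set.Icc x y → f (Real.exp (-u)) = 0 := by
      intro u hu
      refine max_eq_left ?_
      rcases lt_or_ge u x with h1 | h1
      · have h2 : Real.exp (-x) < Real.exp (-u) := Real.exp_lt_exp.2 (by linarith)
        have h3 : Real.exp (-y) < Real.exp (-x) := Real.exp_lt_exp.2 (by linarith)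
        exact mul_nonpos_of_nonneg_of_nonpos (by linarith) (by linarith)
      · have h1' : y < u := by
          by_contra hc
          exact hu ⟨h1, not_lt.1 hc⟩
        have h2 : Real.exp (-u) < Real.exp (-y) := Real.exp_lt_exp.2 (by linarith)
        have h3 : Real.exp (-y) < Real.exp (-x) := Real.exp_lt_exp.2 (by linarith)
        exact mul_nonpos_of_nonpos_of_nonneg (by linarith) (by linarith)
    set k : ℝ → ℝ := fun u => f (Real.exp (-u)) * (Real.exp (-u) * u) with hk
    have hkc : Continuous k := by fun_prop
    have hk0 : ∀ u ∈ Set.Ioi (0 : ℝ), 0 ≤ k u := fun u hu =>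
      mul_nonneg (hf0 _) (mul_nonneg (Real.exp_pos _).le (Set.mem_Ioi.1 hu).le)
    have hki : IntegrableOn k (Set.Ioi 0) := by
      refine Integrable.integrableOn (hkc.integrable_of_hasCompactSupport ?_)
      refine HasCompactSupport.intro (isCompact_Icc (a := x) (b := y)) fun u hu => ?_
      simp [hk, hsupp u hu]
    have hJ : 0 < ∫ u in Set.Ioi (0 : ℝ), k u := by
      rw [setIntegral_pos_iff_support_of_nonneg_ae
        (by filter_upwards [ae_restrict_mem measurableSet_Ioi] with u hu using hk0 u hu) hki]
      refine lt_of_lt_of_le ?_ (measure_mono (s := Set.Ioo x y) ?_)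
      · simp [hxy]
      · intro u hu
        have hu0 : 0 < u := hx.trans hu.1
        refine ⟨?_, hu0⟩
        have h2 : Real.exp (-u) < Real.exp (-x) := Real.exp_lt_exp.2 (by linarith [hu.1])
        have h3 : Real.exp (-y) < Real.exp (-u) := Real.exp_lt_exp.2 (by linarith [hu.2])
        have : 0 < f (Real.exp (-u)) :=
          lt_max_of_lt_right (mul_pos (by linarith) (by linarith))
        have : 0 < k u := by positivity
        exact this.ne'
    -- comparison for any density between two constants on `[x, y]`
    have hcmp : ∀ (w : ℝ → ℝ) (A B : ℝ), (∀ u ∈ Set.Icc x y, A ≤ w u ∧ w u ≤ B) →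
        IntegrableOn (fun u => f (Real.exp (-u)) * (Real.exp (-u) * u * w u)) (Set.Ioi 0) →
        A * (∫ u in Set.Ioi (0 : ℝ), k u) ≤
          ∫ u in Set.Ioi (0 : ℝ), f (Real.exp (-u)) * (Real.exp (-u) * u * w u) ∧
        (∫ u in Set.Ioi (0 : ℝ), f (Real.exp (-u)) * (Real.exp (-u) * u * w u)) ≤
          B * ∫ u in Set.Ioi (0 : ℝ), k u := by
      intro w A B hw hwi
      rw [← integral_const_mul, ← integral_const_mul]
      have hkw : ∀ u, f (Real.exp (-u)) * (Real.exp (-u) * u * w u) = w u * k u := fun u => by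
        simp only [hk]; ring
      constructor
      · refine setIntegral_mono_on (hki.const_mul A) hwi measurableSet_Ioi fun u hu => ?_
        rw [hkw]
        by_cases hu' : u ∈ Set.Icc x y
        · exact mul_le_mul_of_nonneg_right (hw u hu').1 (hk0 u hu)
        · simp [hk, hsupp u hu']
      · refine setIntegral_mono_on hwi (hki.const_mul B) measurableSet_Ioi fun u hu => ?_
        rw [hkw]
        by_cases hu' : u ∈ Set.Icc x y
        · exact mul_le_mul_of_nonneg_right (hw u hu').2 (hk0 u hu)
        · simp [hk, hsupp u hu']
    have hbdd : ∀ w : ℝ → ℝ, IntegrableOn w (Set.Ioi 0) →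
        IntegrableOn (fun u => f (Real.exp (-u)) * w u) (Set.Ioi 0) := by
      intro w hw
      obtain ⟨C, hC⟩ := (isCompact_Icc (a := (0 : ℝ)) (b := 1)).exists_bound_of_continuousOn
        hf.continuousOn
      refine Integrable.bdd_mul (c := C) hw (by fun_prop) ?_
      filter_upwards [ae_restrict_mem measurableSet_Ioi] with u hu
      exact hC _ ⟨(Real.exp_pos _).le, Real.exp_le_one_iff.2 (by linarith [Set.mem_Ioi.1 hu])⟩
    have h0 := hcmp (fun u => u ^ (β - 2) / Real.Gamma β) (y ^ (β - 2) / Real.Gamma β)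
      (x ^ (β - 2) / Real.Gamma β) (fun u hu => by
        have hu0 : 0 < u := hx.trans_le hu.1
        constructor
        · gcongr ?_ / _
          exact Real.rpow_le_rpow_of_nonpos hu0 hu.2 (by linarith)
        · gcongr ?_ / _
          exact Real.rpow_le_rpow_of_nonpos hx hu.1 (by linarith)) (hbdd _ hm₀i)
    refine ⟨_, _, _, hJ, hlim f hf, ?_, h0.1, h0.2⟩
    filter_upwards [hq] with p hp
    exact hcmp (q p) _ _ (fun u hu => ⟨hp.2.1 hu.2, hp.2.1 hu.1⟩) (hbdd _ hp.2.2)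
  have hcont : ContinuousAt (fun y : ℝ => y ^ (β - 2) / Real.Gamma β) 1 :=
    (Real.continuousAt_rpow_const 1 _ (Or.inl one_ne_zero)).div_const _
  rw [ContinuousAt, Real.one_rpow] at hcont
  refine tendsto_order.2 ⟨fun a ha => ?_, fun a ha => ?_⟩
  -- A bump to the right of `1` bounds `q p 1` from below, one to the left bounds it from above.
  -- Continuity of the limit density at `1` lets the bumps be narrow enough.
  · have h1 : ∀ᶠ y in 𝓝[>] (1 : ℝ), a < y ^ (β - 2) / Real.Gamma β :=
      (hcont.mono_left nhdsWithin_le_nhds).eventually_const_lt ha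
    obtain ⟨y, hy, hy1⟩ := (h1.and self_mem_nhdsWithin).exists
    obtain ⟨J, I, I₀, hJ, hI, hc, h3, -⟩ := hbump 1 y one_pos hy1
    have h4 : a * J < I₀ := (mul_lt_mul_of_pos_right hy hJ).trans_le h3
    filter_upwards [hc, hI.eventually_const_lt h4] with p hp hp'
    exact lt_of_mul_lt_mul_right (hp'.trans_le hp.2) hJ.le
  · have h1 : ∀ᶠ y in 𝓝[<] (1 : ℝ), y ^ (β - 2) / Real.Gamma β < a :=
      (hcont.mono_left nhdsWithin_le_nhds).eventually_lt_const ha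
    obtain ⟨x, ⟨hx, hx1⟩, hx0⟩ := ((h1.and self_mem_nhdsWithin).and
      (nhdsWithin_le_nhds (lt_mem_nhds one_pos))).exists
    obtain ⟨J, I, I₀, hJ, hI, hc, -, h3⟩ := hbump x 1 hx0 hx1
    have h4 : I₀ < a * J := h3.trans_lt (mul_lt_mul_of_pos_right hx hJ)
    filter_upwards [hc, hI.eventually_lt_const h4] with p hp hp'
    exact lt_of_mul_lt_mul_right (hp.1.trans_lt hp') hJ.le

/-! ### Regularity and doubling of the characteristic exponent -/

section CharExponent

variable {Ω : Type*} [MeasurableSpace Ω] {P : Measure Ω} [IsProbabilityMeasure P] {d : ℕ}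
  {X : ℝ≥0 → Ω → EuclideanSpace ℝ (Fin d)} {ψ : ℝ → ℝ}

theorem exists_norm_eq_one_euclideanSpace (hd : 1 ≤ d) :
    ∃ e : EuclideanSpace ℝ (Fin d), ‖e‖ = 1 :=
  ⟨EuclideanSpace.single ⟨0, hd⟩ 1, by simp⟩

/-- On a line through a unit vector, `ψ |s|` is minus the logarithm of the modulus of a nonvanishing
characteristic function. The absolute value is needed since `ψ` is arbitrary on negative numbers. -/
theorem HasRadialCharExponent.continuous_comp_abs (hψ : HasRadialCharExponent P X ψ)
    (hX : ∀ t, Measurable (X t)) (hd : 1 ≤ d) : Continuous fun s => ψ |s| := by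
  obtain ⟨e, he⟩ := exists_norm_eq_one_euclideanSpace hd
  have := Measure.isProbabilityMeasure_map (μ := P) (hX 1).aemeasurable
  have h : ∀ s : ℝ, ψ |s| = -Real.log ‖charFun (P.map (X 1)) (s • e)‖ := by
    intro s
    rw [hψ 1, Complex.norm_exp, norm_smul, he]
    simp
  simp_rw [h]
  refine (Continuous.log ?_ fun s => ?_).neg
  · exact (continuous_charFun.comp (by fun_prop)).norm
  · rw [hψ 1]; simp

theorem HasRadialCharExponent.nonneg (hψ : HasRadialCharExponent P X ψ)
    (hX : ∀ t, Measurable (X t)) (hd : 1 ≤ d) {s : ℝ} (hs : 0 ≤ s) : 0 ≤ ψ s := by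
  obtain ⟨e, he⟩ := exists_norm_eq_one_euclideanSpace hd
  have := Measure.isProbabilityMeasure_map (μ := P) (hX 1).aemeasurable
  have h := norm_charFun_le_one (μ := P.map (X 1)) (s • e)
  rw [hψ 1, Complex.norm_exp, norm_smul, he] at h
  simpa [abs_of_nonneg hs] using h

theorem HasRadialCharExponent.apply_zero (hψ : HasRadialCharExponent P X ψ)
    (hX : ∀ t, Measurable (X t)) : ψ 0 = 0 := by
  have := Measure.isProbabilityMeasure_map (μ := P) (hX 1).aemeasurable
  have h := congrArg norm (hψ 1 0)
  rw [charFun_zero, Complex.norm_exp] at h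
  simpa using h.symm

theorem re_charFun {E : Type*} [NormedAddCommGroup E] [InnerProductSpace ℝ E] [MeasurableSpace E]
    [BorelSpace E] [SecondCountableTopology E] (μ : Measure E) [IsFiniteMeasure μ] (ξ : E) :
    (charFun μ ξ).re = ∫ x, Real.cos (inner ℝ x ξ) ∂μ := by
  have hi : Integrable (fun x : E => Complex.exp ((inner ℝ x ξ : ℝ) * Complex.I)) μ := by
    refine Integrable.of_bound (C := 1) (by fun_prop) (ae_of_all _ fun x => ?_)
    rw [Complex.norm_exp_ofReal_mul_I]
  rw [charFun_apply, ← RCLike.re_eq_complex_re, ← integral_re hi]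
  simp [Complex.exp_ofReal_mul_I_re]

/-- Integrate `1 - cos 2θ ≤ 4 (1 - cos θ)`; the difference of the two sides is `2 (1 - cos θ)²`. -/
theorem HasRadialCharExponent.one_sub_exp_doubling (hψ : HasRadialCharExponent P X ψ)
    (hX : ∀ t, Measurable (X t)) (hd : 1 ≤ d) {s : ℝ} (hs : 0 ≤ s) (t : ℝ≥0) :
    1 - Real.exp (-(t * ψ (2 * s))) ≤ 4 * (1 - Real.exp (-(t * ψ s))) := by
  obtain ⟨e, he⟩ := exists_norm_eq_one_euclideanSpace hd
  have := Measure.isProbabilityMeasure_map (μ := P) (hX t).aemeasurable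
  set μ := P.map (X t)
  have h : ∀ r : ℝ, 0 ≤ r →
      Real.exp (-(t * ψ r)) = ∫ x, Real.cos (r * inner ℝ x e) ∂μ := by
    intro r hr
    have := re_charFun μ (r • e)
    rw [hψ t, norm_smul, he, mul_one, Real.norm_of_nonneg hr, ← Complex.ofReal_neg,
      ← Complex.ofReal_exp,
      Complex.ofReal_re] at this
    simpa [inner_smul_right] using this
  have hi : ∀ r : ℝ, Integrable (fun x => Real.cos (r * inner ℝ x e)) μ := fun r =>
    Integrable.of_bound (C := 1) (by fun_prop) (ae_of_all _ fun x => by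
      simpa using Real.abs_cos_le_one _)
  have hone : ∀ r : ℝ, 1 - ∫ x, Real.cos (r * inner ℝ x e) ∂μ =
      ∫ x, (1 - Real.cos (r * inner ℝ x e)) ∂μ := by
    intro r
    rw [integral_sub (integrable_const 1) (hi r)]
    simp
  rw [h _ hs, h _ (by positivity), hone, hone, ← integral_const_mul]
  refine integral_mono ((integrable_const 1).sub (hi _)) (((integrable_const 1).sub (hi _)).const_mul 4)
    fun x => ?_
  simp only [mul_assoc]
  rw [Real.cos_two_mul]
  nlinarith [sq_nonneg (Real.cos (s * inner ℝ x e) - 1)]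

theorem abs_one_sub_exp_neg_sub_le {y : ℝ} (hy : 0 ≤ y) : |1 - Real.exp (-y) - y| ≤ y ^ 2 := by
  have h1 := Real.one_sub_le_exp_neg y
  rcases le_or_gt y 1 with h | h
  · have := Real.abs_exp_sub_one_sub_id_le (x := -y) (by rwa [abs_neg, abs_of_nonneg hy])
    rw [neg_sq] at this
    rw [← abs_neg]
    convert this using 2
    ring
  · rw [abs_of_nonpos (by linarith)]
    have : Real.exp (-y) ≤ 1 := Real.exp_le_one_iff.2 (by linarith)
    nlinarith

/-- Linearise the exponential version in `t`, divide by `t` and let `t → 0`. -/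
theorem HasRadialCharExponent.doubling (hψ : HasRadialCharExponent P X ψ)
    (hX : ∀ t, Measurable (X t)) (hd : 1 ≤ d) {s : ℝ} (hs : 0 ≤ s) : ψ (2 * s) ≤ 4 * ψ s := by
  have ha := hψ.nonneg hX hd (s := 2 * s) (by positivity)
  have hb := hψ.nonneg hX hd hs
  have h : ∀ t : ℝ, 0 < t → ψ (2 * s) - t * ψ (2 * s) ^ 2 ≤ 4 * ψ s := by
    intro t ht
    have h1 := hψ.one_sub_exp_doubling hX hd hs ⟨t, ht.le⟩
    change 1 - Real.exp (-(t * ψ (2 * s))) ≤ 4 * (1 - Real.exp (-(t * ψ s))) at h1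
    have h2 := (abs_le.1 (abs_one_sub_exp_neg_sub_le (y := t * ψ (2 * s)) (by positivity))).1
    have h3 := Real.one_sub_le_exp_neg (t * ψ s)
    have h4 : t * (ψ (2 * s) - t * ψ (2 * s) ^ 2) ≤ t * (4 * ψ s) := by nlinarith
    exact le_of_mul_le_mul_left h4 ht
  have hlim : Tendsto (fun t : ℝ => ψ (2 * s) - t * ψ (2 * s) ^ 2) (𝓝[>] 0)
      (𝓝 (ψ (2 * s) - 0 * ψ (2 * s) ^ 2)) :=
    (Continuous.tendsto (by fun_prop) 0).mono_left nhdsWithin_le_nhds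
  rw [zero_mul, sub_zero] at hlim
  exact le_of_tendsto hlim (by filter_upwards [self_mem_nhdsWithin] with t ht using h t ht)

end CharExponent

/-- Quadratic growth of a continuous function with the doubling property. -/
theorem exists_le_one_add_sq_of_doubling {f : ℝ → ℝ} (hf : Continuous f)
    (h2 : ∀ s, 0 ≤ s → f (2 * s) ≤ 4 * f s) :
    ∃ A, 0 ≤ A ∧ ∀ s, 0 ≤ s → f s ≤ A * (1 + s ^ 2) := by
  obtain ⟨M, hM⟩ := (isCompact_Icc (a := (0 : ℝ)) (b := 1)).exists_bound_of_continuousOn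
    hf.continuousOn
  have hM0 : 0 ≤ M := (norm_nonneg _).trans (hM 0 ⟨le_rfl, zero_le_one⟩)
  have hM' : ∀ s, 0 ≤ s → s ≤ 1 → f s ≤ M := fun s h0 h1 => (le_abs_self _).trans (hM s ⟨h0, h1⟩)
  refine ⟨4 * M, by positivity, fun s hs => ?_⟩
  rcases le_or_gt s 1 with h | h
  · nlinarith [hM' s hs h, sq_nonneg s]
  · have := le_quadratic_of_doubling h2 (x := 1) hM0 zero_le_one
      (fun v hv => by rw [mul_one]; exact hM' v (by linarith [hv.1]) hv.2) (u := s) (by linarith)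
    rw [mul_one] at this
    nlinarith

/-! ### Laplace functionals of tails -/

theorem integrableOn_mul_exp_neg {x : ℝ} (hx : 0 < x) :
    IntegrableOn (fun u : ℝ => Real.exp (-(x * u)) * u) (Set.Ioi 0) := by
  have h := Real.integral_rpow_mul_exp_neg_mul_Ioi (a := 2) two_pos hx
  have h2 : IntegrableOn (fun u : ℝ => u ^ ((2 : ℝ) - 1) * Real.exp (-(x * u))) (Set.Ioi 0) := by
    refine Integrable.of_integral_ne_zero ?_
    rw [h]
    have := Real.Gamma_pos_of_pos (s := 2) two_pos
    positivity
  refine h2.congr_fun (fun u _ => ?_) measurableSet_Ioi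
  norm_num
  ring

theorem integral_mul_exp_neg {x : ℝ} (hx : 0 < x) (y : ℝ) :
    ∫ u in (0 : ℝ)..y, Real.exp (-(x * u)) * u =
      (x ^ 2)⁻¹ * (1 - Real.exp (-(x * y)) * (1 + x * y)) := by
  have h : ∀ u : ℝ, HasDerivAt (fun u => -((x ^ 2)⁻¹ * (Real.exp (-(x * u)) * (1 + x * u))))
      (Real.exp (-(x * u)) * u) u := by
    intro u
    have h1 : HasDerivAt (fun u : ℝ => x * u) x u := by simpa using (hasDerivAt_id u).const_mul x
    refine ((h1.fun_neg.exp.mul (h1.const_add 1)).const_mul ((x ^ 2)⁻¹)).neg.congr_deriv ?_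
    field_simp
    ring
  rw [intervalIntegral.integral_eq_sub_of_hasDerivAt (fun u _ => h u)
    (Continuous.intervalIntegrable (by fun_prop) _ _)]
  simp
  ring

section Laplace

variable {Ω : Type*} [MeasurableSpace Ω] {P : Measure Ω} [IsProbabilityMeasure P] {Y : Ω → ℝ}

theorem one_sub_exp_neg_mul_nonneg (y : ℝ) : 0 ≤ 1 - Real.exp (-y) * (1 + y) := by
  have h := Real.add_one_le_exp y
  have h2 : Real.exp (-y) * Real.exp y = 1 := by rw [← Real.exp_add]; simp
  nlinarith [Real.exp_pos (-y)]

theorem integrableOn_mul_exp_neg_mul_tail {x : ℝ} (hx : 0 < x) :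
    IntegrableOn (fun u : ℝ => Real.exp (-(x * u)) * u * P.real {ω | u ≤ Y ω}) (Set.Ioi 0) := by
  have hanti : Antitone fun u : ℝ => P.real {ω | u ≤ Y ω} := fun a b hab =>
    measureReal_mono fun ω (h : b ≤ Y ω) => hab.trans h
  refine Integrable.mul_bdd (c := 1) (integrableOn_mul_exp_neg hx)
    hanti.measurable.aestronglyMeasurable (ae_of_all _ fun u => ?_)
  rw [Real.norm_of_nonneg measureReal_nonneg]
  exact measureReal_le_one

/-- Layer-cake formula for the weight `u e^{-xu}`, whose primitive is explicit. -/
theorem integral_mul_exp_neg_mul_tail (hY : Measurable Y) (hY0 : ∀ ω, 0 ≤ Y ω) {x : ℝ}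
    (hx : 0 < x) :
    ∫ u in Set.Ioi (0 : ℝ), Real.exp (-(x * u)) * u * P.real {ω | u ≤ Y ω} =
      (x ^ 2)⁻¹ * ∫ ω, (1 - Real.exp (-(x * Y ω)) * (1 + x * Y ω)) ∂P := by
  have key := lintegral_comp_eq_lintegral_meas_le_mul P (f := Y)
    (g := fun u => Real.exp (-(x * u)) * u) (ae_of_all _ hY0) hY.aemeasurable
    (fun t _ => Continuous.intervalIntegrable (by fun_prop) _ _)
    (by filter_upwards [ae_restrict_mem measurableSet_Ioi] with u hu
        exact mul_nonneg (Real.exp_pos _).le (Set.mem_Ioi.1 hu).le)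
  rw [← integral_const_mul, integral_eq_lintegral_of_nonneg_ae, integral_eq_lintegral_of_nonneg_ae]
  · congr 1
    simp_rw [integral_mul_exp_neg hx] at key
    rw [key]
    refine lintegral_congr_ae (ae_of_all _ fun u => ?_)
    simp only
    rw [mul_comm, ENNReal.ofReal_mul measureReal_nonneg, ofReal_measureReal]
  · refine ae_of_all _ fun ω => ?_
    have := one_sub_exp_neg_mul_nonneg (x * Y ω)
    simp only [Pi.zero_apply]
    positivity
  · fun_prop
  · filter_upwards [ae_restrict_mem measurableSet_Ioi] with u hu
    exact mul_nonneg (mul_nonneg (Real.exp_pos _).le (Set.mem_Ioi.1 hu).le) measureReal_nonneg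
  · exact (integrableOn_mul_exp_neg_mul_tail hx).aestronglyMeasurable

/-- The Laplace transform at `x` is the moment generating function at `-x`, an interior point of its
domain because `Y ≥ 0`. -/
theorem hasDerivAt_integral_exp_neg (hY : Measurable Y) (hY0 : ∀ ω, 0 ≤ Y ω) {x : ℝ}
    (hx : 0 < x) :
    Integrable (fun ω => Y ω * Real.exp (-(x * Y ω))) P ∧
    HasDerivAt (fun y => ∫ ω, Real.exp (-(y * Y ω)) ∂P)
      (-∫ ω, Y ω * Real.exp (-(x * Y ω)) ∂P) x := by
  have hsub : Set.Iio 0 ⊆ integrableExpSet Y P := by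
    intro s hs
    refine Integrable.of_bound (C := 1) (by fun_prop) (ae_of_all _ fun ω => ?_)
    rw [Real.norm_of_nonneg (Real.exp_pos _).le]
    exact Real.exp_le_one_iff.2 (mul_nonpos_of_nonpos_of_nonneg (Set.mem_Iio.1 hs).le (hY0 ω))
  have hmem : -x ∈ interior (integrableExpSet Y P) :=
    interior_maximal hsub isOpen_Iio (by simpa using hx)
  constructor
  · simpa using integrable_pow_mul_exp_of_mem_interior_integrableExpSet hmem 1
  · have h := (hasDerivAt_mgf hmem).scomp x (hasDerivAt_neg x)
    simpa [mgf, Function.comp_def] using h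

end Laplace

/-! ### Gaussian averages and subordination -/

section Gaussian

variable {d : ℕ}

theorem integrable_rpow_norm_mul_exp_neg_mul_sq (hd : 1 ≤ d) {b s : ℝ} (hb : 0 < b)
    (hs : -(d : ℝ) < s) :
    Integrable fun ξ : EuclideanSpace ℝ (Fin d) => ‖ξ‖ ^ s * Real.exp (-b * ‖ξ‖ ^ 2) := by
  have : Nonempty (Fin d) := ⟨⟨0, hd⟩⟩
  rw [integrable_fun_norm_addHaar (μ := (volume : Measure (EuclideanSpace ℝ (Fin d))))
    (f := fun y => y ^ s * Real.exp (-b * y ^ 2)), finrank_euclideanSpace_fin]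
  refine (integrableOn_rpow_mul_exp_neg_mul_sq hb (s := s + (d - 1)) (by linarith)).congr_fun
    (fun y hy => ?_) measurableSet_Ioi
  have hy' : 0 < y := hy
  simp only [smul_eq_mul]
  rw [Real.rpow_add hy', ← Real.rpow_natCast y (d - 1), Nat.cast_sub hd]
  push_cast
  ring

theorem integrable_exp_neg_mul_sq_mul (hd : 1 ≤ d) {b A : ℝ} (hb : 0 < b) {n : ℕ} {w : ℝ → ℝ}
    (hw : Continuous w) (hA : ∀ s, 0 ≤ s → |w s| ≤ A * (1 + s ^ n)) :
    Integrable fun ξ : EuclideanSpace ℝ (Fin d) => Real.exp (-b * ‖ξ‖ ^ 2) * w ‖ξ‖ := by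
  have h : ∀ k : ℕ, Integrable fun ξ : EuclideanSpace ℝ (Fin d) =>
      ‖ξ‖ ^ k * Real.exp (-b * ‖ξ‖ ^ 2) := by
    intro k
    have hk : -(d : ℝ) < k := by
      have : (1 : ℝ) ≤ d := by exact_mod_cast hd
      have : (0 : ℝ) ≤ k := k.cast_nonneg
      linarith
    simpa using integrable_rpow_norm_mul_exp_neg_mul_sq hd hb hk
  refine (((h 0).add (h n)).const_mul A).mono' (by fun_prop) (ae_of_all _ fun ξ => ?_)
  rw [norm_mul, Real.norm_of_nonneg (Real.exp_pos _).le, Real.norm_eq_abs]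
  calc Real.exp (-b * ‖ξ‖ ^ 2) * |w ‖ξ‖|
      ≤ Real.exp (-b * ‖ξ‖ ^ 2) * (A * (1 + ‖ξ‖ ^ n)) := by gcongr; exact hA _ (norm_nonneg _)
    _ = _ := by simp; ring

theorem integral_comp_norm_mul_sqrt (w : ℝ → ℝ) {y : ℝ} (hy : 0 < y) :
    ∫ ξ : EuclideanSpace ℝ (Fin d), w (‖ξ‖ * √y) =
      y ^ (-(d : ℝ) / 2) * ∫ ξ : EuclideanSpace ℝ (Fin d), w ‖ξ‖ := by
  have h := Measure.integral_comp_smul (volume : Measure (EuclideanSpace ℝ (Fin d)))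
    (fun ξ => w ‖ξ‖) (√y)
  rw [finrank_euclideanSpace_fin, abs_of_nonneg (by positivity), smul_eq_mul] at h
  have h2 : ((√y) ^ d)⁻¹ = y ^ (-(d : ℝ) / 2) := by
    rw [Real.sqrt_eq_rpow, ← Real.rpow_natCast, ← Real.rpow_mul hy.le, ← Real.rpow_neg hy.le]
    congr 1
    ring
  rw [← h2, ← h]
  simp_rw [norm_smul, Real.norm_of_nonneg (Real.sqrt_nonneg y), mul_comm]

variable {Ψ : ℝ → ℝ} {A : ℝ}

/-- Since `Ψ` is only continuous, rescaling `ξ` first moves the parameter from `Ψ` into the Gaussian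
density; then one differentiates under the integral. -/
theorem hasDerivAt_gaussian_average (hd : 1 ≤ d) (hΨ : Continuous Ψ)
    (hA : ∀ s, 0 ≤ s → |Ψ s| ≤ A * (1 + s ^ 2)) {x : ℝ} (hx : 0 < x) :
    HasDerivAt (fun y => ∫ ξ : EuclideanSpace ℝ (Fin d),
        Real.exp (-‖ξ‖ ^ 2 / 4) * Ψ (‖ξ‖ * √y))
      (x⁻¹ * ∫ ξ : EuclideanSpace ℝ (Fin d), (‖ξ‖ ^ 2 / 4 - d / 2) *
        (Real.exp (-‖ξ‖ ^ 2 / 4) * Ψ (‖ξ‖ * √x))) x := by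
  have hA0 : 0 ≤ A := by simpa using (abs_nonneg _).trans (hA 0 le_rfl)
  let J : ℝ → ℝ := fun y => ∫ ξ : EuclideanSpace ℝ (Fin d),
    Real.exp (-‖ξ‖ ^ 2 / (4 * y)) * Ψ ‖ξ‖
  let J' : ℝ := ∫ ξ : EuclideanSpace ℝ (Fin d),
    Real.exp (-‖ξ‖ ^ 2 / (4 * x)) * (‖ξ‖ ^ 2 / (4 * x ^ 2)) * Ψ ‖ξ‖
  have hexp : ∀ y s : ℝ, Real.exp (-s ^ 2 / (4 * y)) = Real.exp (-(4 * y)⁻¹ * s ^ 2) := by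
    intro y s; congr 1; ring
  have hint : ∀ y : ℝ, 0 < y → ∀ {w : ℝ → ℝ} {B : ℝ}, Continuous w →
      (∀ s, 0 ≤ s → |w s| ≤ B * (1 + s ^ 4)) →
      Integrable fun ξ : EuclideanSpace ℝ (Fin d) => Real.exp (-‖ξ‖ ^ 2 / (4 * y)) * w ‖ξ‖ := by
    intro y hy w B hw hB
    simp_rw [hexp]
    exact integrable_exp_neg_mul_sq_mul hd (by positivity) hw hB
  have hΨ4 : ∀ s, 0 ≤ s → |Ψ s| ≤ 2 * A * (1 + s ^ 4) := fun s hs =>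
    (hA s hs).trans (by
      have : A * (1 + s ^ 2) ≤ A * (2 * (1 + s ^ 4)) := by
        gcongr; nlinarith [sq_nonneg (s ^ 2 - 1)]
      linarith)
  have hs2 : ∀ s, 0 ≤ s → |s ^ 2 * Ψ s| ≤ 2 * A * (1 + s ^ 4) := by
    intro s hs
    rw [abs_mul, abs_of_nonneg (sq_nonneg s)]
    calc s ^ 2 * |Ψ s| ≤ s ^ 2 * (A * (1 + s ^ 2)) := by gcongr; exact hA s hs
      _ = A * (s ^ 2 + s ^ 4) := by ring
      _ ≤ A * (2 * (1 + s ^ 4)) := by gcongr; nlinarith [sq_nonneg (s ^ 2 - 1)]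
      _ = _ := by ring
  have hJ : HasDerivAt J J' x := by
    refine (hasDerivAt_integral_of_dominated_loc_of_deriv_le
      (F := fun y (ξ : EuclideanSpace ℝ (Fin d)) => Real.exp (-‖ξ‖ ^ 2 / (4 * y)) * Ψ ‖ξ‖)
      (F' := fun y (ξ : EuclideanSpace ℝ (Fin d)) =>
        Real.exp (-‖ξ‖ ^ 2 / (4 * y)) * (‖ξ‖ ^ 2 / (4 * y ^ 2)) * Ψ ‖ξ‖)
      (s := Set.Ioo (x / 2) (2 * x)) (Ioo_mem_nhds (by linarith) (by linarith))
      -- On `(x/2, 2x)`, `y < 2x` bounds the exponential and `y > x/2` gives `4y² ≥ x²`.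
      (bound := fun ξ => Real.exp (-‖ξ‖ ^ 2 / (4 * (2 * x))) * ((x ^ 2)⁻¹ * (‖ξ‖ ^ 2 * |Ψ ‖ξ‖|)))
      (Eventually.of_forall fun y => by fun_prop) (hint x hx hΨ hΨ4)
      (by fun_prop) (ae_of_all _ fun ξ y hy => ?_) ?_ (ae_of_all _ fun ξ y hy => ?_)).2
    · have hy0 : 0 < y := by linarith [hy.1]
      rw [norm_mul, Real.norm_of_nonneg (by positivity), Real.norm_eq_abs, mul_assoc]
      have e1 : Real.exp (-‖ξ‖ ^ 2 / (4 * y)) ≤ Real.exp (-‖ξ‖ ^ 2 / (4 * (2 * x))) := by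
        rw [Real.exp_le_exp, neg_div, neg_div, neg_le_neg_iff]
        gcongr
        exact hy.2.le
      have e2 : ‖ξ‖ ^ 2 / (4 * y ^ 2) ≤ (x ^ 2)⁻¹ * ‖ξ‖ ^ 2 := by
        rw [div_eq_mul_inv, mul_comm]
        gcongr
        nlinarith [hy.1]
      calc _ ≤ Real.exp (-‖ξ‖ ^ 2 / (4 * (2 * x))) * ((x ^ 2)⁻¹ * ‖ξ‖ ^ 2 * |Ψ ‖ξ‖|) := by gcongr
        _ = _ := by ring
    · refine hint (2 * x) (by positivity) (w := fun s => (x ^ 2)⁻¹ * (s ^ 2 * |Ψ s|))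
        (B := (x ^ 2)⁻¹ * (2 * A)) (by fun_prop) fun s hs => ?_
      rw [abs_mul, abs_of_nonneg (by positivity : (0 : ℝ) ≤ (x ^ 2)⁻¹), mul_assoc]
      gcongr
      simpa [abs_mul] using hs2 s hs
    · have hy0 : 0 < y := by linarith [hy.1]
      have h1 : HasDerivAt (fun y : ℝ => -‖ξ‖ ^ 2 / (4 * y)) (‖ξ‖ ^ 2 / (4 * y ^ 2)) y := by
        have := (((hasDerivAt_id y).const_mul 4).inv (by simpa using hy0.ne')).const_mul (-‖ξ‖ ^ 2)
        refine (this.congr_deriv ?_)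
        simp
        field_simp
      exact h1.exp.mul_const _
  have hscale : ∀ y : ℝ, 0 < y → ∫ ξ : EuclideanSpace ℝ (Fin d),
      Real.exp (-‖ξ‖ ^ 2 / 4) * Ψ (‖ξ‖ * √y) = y ^ (-(d : ℝ) / 2) * J y := by
    intro y hy
    rw [← integral_comp_norm_mul_sqrt (fun s => Real.exp (-s ^ 2 / (4 * y)) * Ψ s) hy]
    refine integral_congr_ae (ae_of_all _ fun ξ => ?_)
    simp only [mul_pow, Real.sq_sqrt hy.le]
    congr 2
    field_simp
  have hscale' : ∫ ξ : EuclideanSpace ℝ (Fin d), (‖ξ‖ ^ 2 / 4 - d / 2) *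
      (Real.exp (-‖ξ‖ ^ 2 / 4) * Ψ (‖ξ‖ * √x)) = x ^ (-(d : ℝ) / 2) * (x * J' - d / 2 * J x) := by
    have e1 : x * J' - d / 2 * J x = ∫ ξ : EuclideanSpace ℝ (Fin d),
        (‖ξ‖ ^ 2 / (4 * x) - d / 2) * (Real.exp (-‖ξ‖ ^ 2 / (4 * x)) * Ψ ‖ξ‖) := by
      simp only [J, J']
      rw [← integral_const_mul, ← integral_const_mul, ← integral_sub]
      · refine integral_congr_ae (ae_of_all _ fun ξ => ?_)
        simp only
        field_simp
      · refine Integrable.const_mul ?_ _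
        have := (hint x hx (w := fun s => s ^ 2 * Ψ s) (by fun_prop) hs2).const_mul (4 * x ^ 2)⁻¹
        refine this.congr (ae_of_all _ fun ξ => ?_)
        simp only
        field_simp
      · exact (hint x hx hΨ hΨ4).const_mul _
    rw [e1, ← integral_comp_norm_mul_sqrt
      (fun s => (s ^ 2 / (4 * x) - d / 2) * (Real.exp (-s ^ 2 / (4 * x)) * Ψ s)) hx]
    refine integral_congr_ae (ae_of_all _ fun ξ => ?_)
    have e2 : ‖ξ‖ ^ 2 * x / (4 * x) = ‖ξ‖ ^ 2 / 4 := by field_simp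
    simp only [mul_pow, Real.sq_sqrt hx.le, neg_div, e2]
  have hprod := (Real.hasDerivAt_rpow_const (x := x) (p := -(d : ℝ) / 2) (Or.inl hx.ne')).mul hJ
  have heq : (fun y => ∫ ξ : EuclideanSpace ℝ (Fin d),
      Real.exp (-‖ξ‖ ^ 2 / 4) * Ψ (‖ξ‖ * √y)) =ᶠ[𝓝 x] fun y => y ^ (-(d : ℝ) / 2) * J y := by
    filter_upwards [lt_mem_nhds hx] with y hy using hscale y hy
  refine (hprod.congr_of_eventuallyEq heq).congr_deriv ?_
  rw [hscale', Real.rpow_sub_one hx.ne']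
  field_simp
  ring

/-- The combination `Φ - x Φ'` of a Gaussian average `Φ` is again a Gaussian average. -/
theorem gaussian_average_sub_mul_deriv (hd : 1 ≤ d) (hΨ : Continuous Ψ)
    (hA : ∀ s, 0 ≤ s → |Ψ s| ≤ A * (1 + s ^ 2)) {x : ℝ} (hx : 0 < x) {D : ℝ}
    (hD : HasDerivAt (fun y => (4 * Real.pi) ^ (-(d : ℝ) / 2) *
      ∫ ξ : EuclideanSpace ℝ (Fin d), Real.exp (-‖ξ‖ ^ 2 / 4) * Ψ (‖ξ‖ * √y)) D x) :
    Integrable (fun ξ : EuclideanSpace ℝ (Fin d) =>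
      (1 + d / 2 - ‖ξ‖ ^ 2 / 4) * Real.exp (-‖ξ‖ ^ 2 / 4) * Ψ (‖ξ‖ * √x)) ∧
    (4 * Real.pi) ^ (-(d : ℝ) / 2) *
        (∫ ξ : EuclideanSpace ℝ (Fin d), Real.exp (-‖ξ‖ ^ 2 / 4) * Ψ (‖ξ‖ * √x)) - x * D =
      (4 * Real.pi) ^ (-(d : ℝ) / 2) * ∫ ξ : EuclideanSpace ℝ (Fin d),
        (1 + d / 2 - ‖ξ‖ ^ 2 / 4) * Real.exp (-‖ξ‖ ^ 2 / 4) * Ψ (‖ξ‖ * √x) := by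
  have hA0 : 0 ≤ A := by simpa using (abs_nonneg _).trans (hA 0 le_rfl)
  have hexp : ∀ s : ℝ, Real.exp (-s ^ 2 / 4) = Real.exp (-(1 / 4 : ℝ) * s ^ 2) := by
    intro s; congr 1; ring
  have hb : ∀ s : ℝ, 0 ≤ s → |Ψ (s * √x)| ≤ A * (1 + x) * (1 + s ^ 2) := by
    intro s hs
    refine (hA _ (by positivity)).trans ?_
    rw [mul_pow, Real.sq_sqrt hx.le, mul_assoc]
    gcongr
    nlinarith [sq_nonneg s]
  have i1 : Integrable fun ξ : EuclideanSpace ℝ (Fin d) =>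
      Real.exp (-‖ξ‖ ^ 2 / 4) * Ψ (‖ξ‖ * √x) := by
    simp_rw [hexp]
    exact integrable_exp_neg_mul_sq_mul hd (by norm_num) (w := fun s => Ψ (s * √x)) (by fun_prop) hb
  have i2 : Integrable fun ξ : EuclideanSpace ℝ (Fin d) =>
      Real.exp (-‖ξ‖ ^ 2 / 4) * (‖ξ‖ ^ 2 * Ψ (‖ξ‖ * √x)) := by
    simp_rw [hexp]
    refine integrable_exp_neg_mul_sq_mul hd (by norm_num) (w := fun s => s ^ 2 * Ψ (s * √x))
      (A := 2 * (A * (1 + x))) (n := 4) (by fun_prop) fun s hs => ?_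
    rw [abs_mul, abs_of_nonneg (sq_nonneg s)]
    calc s ^ 2 * |Ψ (s * √x)| ≤ s ^ 2 * (A * (1 + x) * (1 + s ^ 2)) := by gcongr; exact hb s hs
      _ = A * (1 + x) * (s ^ 2 + s ^ 4) := by ring
      _ ≤ A * (1 + x) * (2 * (1 + s ^ 4)) := by gcongr; nlinarith [sq_nonneg (s ^ 2 - 1)]
      _ = _ := by ring
  have i3 : Integrable fun ξ : EuclideanSpace ℝ (Fin d) =>
      (‖ξ‖ ^ 2 / 4 - d / 2) * (Real.exp (-‖ξ‖ ^ 2 / 4) * Ψ (‖ξ‖ * √x)) := by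
    refine ((i2.const_mul (1 / 4)).sub (i1.const_mul (d / 2 : ℝ))).congr (ae_of_all _ fun ξ => ?_)
    simp only [Pi.sub_apply]
    ring
  have e : ∀ ξ : EuclideanSpace ℝ (Fin d),
      (1 + d / 2 - ‖ξ‖ ^ 2 / 4) * Real.exp (-‖ξ‖ ^ 2 / 4) * Ψ (‖ξ‖ * √x) =
      Real.exp (-‖ξ‖ ^ 2 / 4) * Ψ (‖ξ‖ * √x) -
        (‖ξ‖ ^ 2 / 4 - d / 2) * (Real.exp (-‖ξ‖ ^ 2 / 4) * Ψ (‖ξ‖ * √x)) := fun ξ => by ring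
  simp_rw [e]
  refine ⟨i1.sub i3, ?_⟩
  rw [hD.unique ((hasDerivAt_gaussian_average hd hΨ hA hx).const_mul _), integral_sub i1 i3,
    mul_left_comm x, mul_inv_cancel_left₀ hx.ne']
  ring

theorem four_pi_rpow_mul_cpow :
    (((4 * Real.pi) ^ (-(d : ℝ) / 2) : ℝ) : ℂ) * ((Real.pi : ℂ) / (1 / 4 : ℂ)) ^ ((d : ℂ) / 2) = 1 := by
  have h : ((Real.pi : ℂ) / (1 / 4 : ℂ)) ^ ((d : ℂ) / 2) =
      (((4 * Real.pi) ^ ((d : ℝ) / 2) : ℝ) : ℂ) := by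
    rw [Complex.ofReal_cpow (by positivity)]
    push_cast
    congr 1
    ring
  rw [h, ← Complex.ofReal_mul, ← Real.rpow_add (by positivity)]
  simp [neg_div]

/-- Gaussian subordination of the characteristic function. -/
theorem integral_exp_neg_mul_norm_sq_eq {μ : Measure (EuclideanSpace ℝ (Fin d))}
    [IsProbabilityMeasure μ] {Ψ : ℝ → ℝ}
    (h : ∀ ξ, charFun μ ξ = (Ψ ‖ξ‖ : ℂ)) {x : ℝ} (hx : 0 ≤ x) :
    ∫ z, Real.exp (-(x * ‖z‖ ^ 2)) ∂μ = (4 * Real.pi) ^ (-(d : ℝ) / 2) *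
      ∫ ξ : EuclideanSpace ℝ (Fin d), Real.exp (-‖ξ‖ ^ 2 / 4) * Ψ (‖ξ‖ * √x) := by
  -- Fubini for `exp(-‖ξ‖²/4 + i√x ⟨z, ξ⟩)`: integrating over `ξ` gives the Gaussian in `z`,
  -- integrating over `z` gives the characteristic function at `√x ξ`.
  have hinner : ∀ z : EuclideanSpace ℝ (Fin d), ∫ ξ : EuclideanSpace ℝ (Fin d),
      Complex.exp (-(1 / 4 : ℂ) * ‖ξ‖ ^ 2 + (Complex.I * √x) * (inner ℝ z ξ : ℝ)) =
      ((Real.pi : ℂ) / (1 / 4 : ℂ)) ^ ((d : ℂ) / 2) * (Real.exp (-(x * ‖z‖ ^ 2)) : ℂ) := by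
    intro z
    have h1 := GaussianFourier.integral_cexp_neg_mul_sq_norm_add (b := (1 / 4 : ℂ)) (by norm_num)
      (Complex.I * √x) z
    rw [h1, finrank_euclideanSpace_fin]
    congr 1
    rw [Complex.ofReal_exp]
    congr 1
    rw [mul_pow, Complex.I_sq, ← Complex.ofReal_pow (√x), Real.sq_sqrt hx]
    push_cast
    ring
  have hprod : Integrable (fun p : EuclideanSpace ℝ (Fin d) × EuclideanSpace ℝ (Fin d) =>
      Complex.exp (-(1 / 4 : ℂ) * ‖p.2‖ ^ 2 + (Complex.I * √x) * (inner ℝ p.1 p.2 : ℝ)))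
      (μ.prod volume) := by
    have hg : Integrable fun ξ : EuclideanSpace ℝ (Fin d) =>
        Complex.exp (-(1 / 4 : ℂ) * ‖ξ‖ ^ 2 + 0 * (inner ℝ (0 : EuclideanSpace ℝ (Fin d)) ξ : ℝ)) :=
      GaussianFourier.integrable_cexp_neg_mul_sq_norm_add (by norm_num) 0 0
    refine (hg.comp_snd μ).norm.mono' (by fun_prop) (ae_of_all _ fun p => ?_)
    simp [Complex.norm_exp]
  have hswap := integral_integral_swap (f := fun z ξ : EuclideanSpace ℝ (Fin d) =>
    Complex.exp (-(1 / 4 : ℂ) * ‖ξ‖ ^ 2 + (Complex.I * √x) * (inner ℝ z ξ : ℝ))) hprod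
  simp_rw [hinner] at hswap
  rw [integral_const_mul, integral_complex_ofReal] at hswap
  have hright : ∀ ξ : EuclideanSpace ℝ (Fin d), ∫ z, Complex.exp
      (-(1 / 4 : ℂ) * ‖ξ‖ ^ 2 + (Complex.I * √x) * (inner ℝ z ξ : ℝ)) ∂μ =
      ((Real.exp (-‖ξ‖ ^ 2 / 4) * Ψ (‖ξ‖ * √x) : ℝ) : ℂ) := by
    intro ξ
    have h1 := h (√x • ξ)
    rw [norm_smul, Real.norm_of_nonneg (Real.sqrt_nonneg x), charFun_apply, mul_comm (√x)] at h1
    rw [Complex.ofReal_mul, ← h1, ← integral_const_mul]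
    refine integral_congr_ae (ae_of_all _ fun z => ?_)
    simp only
    rw [Complex.ofReal_exp, ← Complex.exp_add, inner_smul_right]
    congr 1
    push_cast
    ring
  simp_rw [hright] at hswap
  rw [integral_complex_ofReal] at hswap
  have := congrArg (fun w : ℂ => (((4 * Real.pi) ^ (-(d : ℝ) / 2) : ℝ) : ℂ) * w) hswap
  rw [← mul_assoc, four_pi_rpow_mul_cpow, one_mul, ← Complex.ofReal_mul] at this
  exact_mod_cast this

end Gaussian

/-! ### Linearisation and tail asymptotics -/

section Tail

variable {Ω : Type*} [MeasurableSpace Ω] {P : Measure Ω} [IsProbabilityMeasure P] {d : ℕ}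
  {X : ℝ≥0 → Ω → EuclideanSpace ℝ (Fin d)} {ψ : ℝ → ℝ}

theorem auxH_eq_integral (hd : 1 ≤ d) (hc : Continuous ψ) {A : ℝ}
    (hA : ∀ s, 0 ≤ s → |ψ s| ≤ A * (1 + s ^ 2)) {x : ℝ} (hx : 0 < x) :
    Integrable (fun ξ : EuclideanSpace ℝ (Fin d) =>
      (1 + d / 2 - ‖ξ‖ ^ 2 / 4) * Real.exp (-‖ξ‖ ^ 2 / 4) * ψ (‖ξ‖ * √x)) ∧
    auxH d ψ x = (4 * Real.pi) ^ (-(d : ℝ) / 2) * ∫ ξ : EuclideanSpace ℝ (Fin d),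
        (1 + d / 2 - ‖ξ‖ ^ 2 / 4) * Real.exp (-‖ξ‖ ^ 2 / 4) * ψ (‖ξ‖ * √x) :=
  gaussian_average_sub_mul_deriv hd hc hA hx
    ((hasDerivAt_gaussian_average hd hc hA hx).const_mul _).differentiableAt.hasDerivAt

theorem gaussian_average_one (y : ℝ) (hy : 0 ≤ y) :
    (4 * Real.pi) ^ (-(d : ℝ) / 2) * (∫ ξ : EuclideanSpace ℝ (Fin d),
      Real.exp (-‖ξ‖ ^ 2 / 4) * (fun _ : ℝ => (1 : ℝ)) (‖ξ‖ * √y)) = 1 := by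
  rw [← integral_exp_neg_mul_norm_sq_eq (μ := Measure.dirac (0 : EuclideanSpace ℝ (Fin d)))
    (Ψ := fun _ => 1) (fun ξ => by simp) hy]
  simp

/-- An exact identity: apply `1 - x d/dx` to the Gaussian averages of `1`, `e^{-tψ}` and `tψ`. All
three acquire the same signed weight, so they combine by linearity. -/
theorem integral_one_sub_exp_sub_auxH (hd : 1 ≤ d) (hX : ∀ t, Measurable (X t))
    (hψ : HasRadialCharExponent P X ψ) (hc : Continuous ψ) (t : ℝ≥0) {x : ℝ} (hx : 0 < x) :
    (∫ ω, (1 - Real.exp (-(x * ‖X t ω‖ ^ 2)) * (1 + x * ‖X t ω‖ ^ 2)) ∂P) - t * auxH d ψ x =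
      (4 * Real.pi) ^ (-(d : ℝ) / 2) * ∫ ξ : EuclideanSpace ℝ (Fin d),
        (1 + d / 2 - ‖ξ‖ ^ 2 / 4) * Real.exp (-‖ξ‖ ^ 2 / 4) *
          (1 - Real.exp (-(t * ψ (‖ξ‖ * √x))) - t * ψ (‖ξ‖ * √x)) := by
  have hnn : ∀ s, 0 ≤ s → 0 ≤ ψ s := fun s hs => hψ.nonneg hX hd hs
  obtain ⟨A, -, hA⟩ := exists_le_one_add_sq_of_doubling hc fun s hs => hψ.doubling hX hd hs
  obtain ⟨iH, eH⟩ := auxH_eq_integral hd hc (A := A)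
    (fun s hs => by rw [abs_of_nonneg (hnn s hs)]; exact hA s hs) hx
  have hY : Measurable fun ω => ‖X t ω‖ ^ 2 := (hX t).norm.pow_const 2
  have := Measure.isProbabilityMeasure_map (μ := P) (hX t).aemeasurable
  have hL : ∀ y : ℝ, 0 ≤ y → ∫ ω, Real.exp (-(y * ‖X t ω‖ ^ 2)) ∂P =
      (4 * Real.pi) ^ (-(d : ℝ) / 2) * ∫ ξ : EuclideanSpace ℝ (Fin d),
        Real.exp (-‖ξ‖ ^ 2 / 4) * (fun s => Real.exp (-(t * ψ s))) (‖ξ‖ * √y) := by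
    intro y hy
    rw [← integral_exp_neg_mul_norm_sq_eq (μ := P.map (X t))
        (Ψ := fun s => Real.exp (-(t * ψ s))) (fun ξ => by rw [hψ t]; simp) hy,
      integral_map (hX t).aemeasurable (by fun_prop)]
  obtain ⟨iY, hYd⟩ := hasDerivAt_integral_exp_neg (P := P) hY (fun ω => sq_nonneg _) hx
  obtain ⟨i1, e1⟩ := gaussian_average_sub_mul_deriv hd (Ψ := fun s => Real.exp (-(t * ψ s)))
    (A := 1) (by fun_prop) (fun s hs => by
      have := hnn s hs
      rw [abs_of_nonneg (Real.exp_pos _).le, one_mul]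
      refine (Real.exp_le_one_iff.2 (neg_nonpos.2 (by positivity))).trans ?_
      nlinarith) hx (hYd.congr_of_eventuallyEq (by
        filter_upwards [lt_mem_nhds hx] with y hy using (hL y hy.le).symm))
  obtain ⟨i2, e2⟩ := gaussian_average_sub_mul_deriv hd (Ψ := fun _ => (1 : ℝ))
    (A := 1) continuous_const (fun s hs => by
      rw [abs_one, one_mul]; nlinarith) hx ((hasDerivAt_const x (1 : ℝ)).congr_of_eventuallyEq (by
        filter_upwards [lt_mem_nhds hx] with y hy using gaussian_average_one y hy.le))
  rw [gaussian_average_one x hx.le] at e2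
  rw [← hL x hx.le] at e1
  have hE : ∫ ω, (1 - Real.exp (-(x * ‖X t ω‖ ^ 2)) * (1 + x * ‖X t ω‖ ^ 2)) ∂P =
      1 - (∫ ω, Real.exp (-(x * ‖X t ω‖ ^ 2)) ∂P) -
        x * ∫ ω, ‖X t ω‖ ^ 2 * Real.exp (-(x * ‖X t ω‖ ^ 2)) ∂P := by
    have iL : Integrable (fun ω => Real.exp (-(x * ‖X t ω‖ ^ 2))) P := by
      refine Integrable.of_bound (C := 1) (by fun_prop) (ae_of_all _ fun ω => ?_)
      rw [Real.norm_of_nonneg (Real.exp_pos _).le]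
      exact Real.exp_le_one_iff.2 (neg_nonpos.2 (by positivity))
    have e3 : ∀ ω, 1 - Real.exp (-(x * ‖X t ω‖ ^ 2)) * (1 + x * ‖X t ω‖ ^ 2) =
        1 - Real.exp (-(x * ‖X t ω‖ ^ 2)) - x * (‖X t ω‖ ^ 2 * Real.exp (-(x * ‖X t ω‖ ^ 2))) :=
      fun ω => by ring
    simp_rw [e3]
    have i3 : Integrable (fun ω => 1 - Real.exp (-(x * ‖X t ω‖ ^ 2))) P :=
      (integrable_const 1).sub iL
    rw [integral_sub i3 (iY.const_mul x),
      integral_sub (integrable_const 1) iL, integral_const_mul]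
    simp
  have e4 : ∀ ξ : EuclideanSpace ℝ (Fin d), (1 + d / 2 - ‖ξ‖ ^ 2 / 4) * Real.exp (-‖ξ‖ ^ 2 / 4) *
      (1 - Real.exp (-(t * ψ (‖ξ‖ * √x))) - t * ψ (‖ξ‖ * √x)) =
      (1 + d / 2 - ‖ξ‖ ^ 2 / 4) * Real.exp (-‖ξ‖ ^ 2 / 4) * 1 -
      (1 + d / 2 - ‖ξ‖ ^ 2 / 4) * Real.exp (-‖ξ‖ ^ 2 / 4) * Real.exp (-(t * ψ (‖ξ‖ * √x))) -
      t * ((1 + d / 2 - ‖ξ‖ ^ 2 / 4) * Real.exp (-‖ξ‖ ^ 2 / 4) * ψ (‖ξ‖ * √x)) := fun ξ => by ring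
  simp_rw [e4]
  have i4 : Integrable fun ξ : EuclideanSpace ℝ (Fin d) =>
      (1 + d / 2 - ‖ξ‖ ^ 2 / 4) * Real.exp (-‖ξ‖ ^ 2 / 4) * 1 -
      (1 + d / 2 - ‖ξ‖ ^ 2 / 4) * Real.exp (-‖ξ‖ ^ 2 / 4) * Real.exp (-(t * ψ (‖ξ‖ * √x))) :=
    i2.sub i1
  rw [integral_sub i4 (iH.const_mul _), integral_sub i2 i1, integral_const_mul, hE, eH]
  linear_combination e2 - e1

/-- The Potter exponent `1/4` is small enough: squaring produces the singularity `‖ξ‖^(-1/2)`,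
integrable at the origin even in dimension one. -/
theorem integrable_weight_mul_potter_sq (hd : 1 ≤ d) :
    Integrable fun ξ : EuclideanSpace ℝ (Fin d) =>
      (1 + d / 2 + ‖ξ‖ ^ 2 / 4) * Real.exp (-‖ξ‖ ^ 2 / 4) *
        (‖ξ‖ ^ (-(1 / 4 : ℝ)) + ‖ξ‖ ^ 2) ^ 2 := by
  have hd1 : (1 : ℝ) ≤ d := by exact_mod_cast hd
  have h : ∀ s : ℝ, -1 < s → Integrable fun ξ : EuclideanSpace ℝ (Fin d) =>
      ‖ξ‖ ^ s * Real.exp (-(1 / 4 : ℝ) * ‖ξ‖ ^ 2) := fun s hs =>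
    integrable_rpow_norm_mul_exp_neg_mul_sq hd (by norm_num) (by linarith)
  have hsum := (((h (-1 / 2) (by norm_num)).add (h 4 (by norm_num))).const_mul
    (2 * (1 + d / 2 : ℝ))).add
    (((h (3 / 2) (by norm_num)).add (h 6 (by norm_num))).const_mul (1 / 2 : ℝ))
  refine hsum.mono' (by fun_prop) (ae_of_all _ fun ξ => ?_)
  rw [Real.norm_of_nonneg (by positivity)]
  have hs : 0 ≤ ‖ξ‖ := norm_nonneg ξ
  simp only [Pi.add_apply]
  generalize ‖ξ‖ = s at hs ⊢
  have e1 : (s ^ (-(1 / 4 : ℝ))) ^ 2 = s ^ (-1 / 2 : ℝ) := by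
    rw [← Real.rpow_natCast, ← Real.rpow_mul hs]; norm_num
  have e2 : s ^ 2 * s ^ (-1 / 2 : ℝ) = s ^ (3 / 2 : ℝ) := by
    rw [← Real.rpow_natCast s 2, ← Real.rpow_add' hs (by norm_num)]; norm_num
  have e3 : s ^ (4 : ℝ) = s ^ 4 := by exact_mod_cast Real.rpow_natCast s 4
  have e4 : s ^ (6 : ℝ) = s ^ 6 := by exact_mod_cast Real.rpow_natCast s 6
  have e5 : Real.exp (-s ^ 2 / 4) = Real.exp (-(1 / 4 : ℝ) * s ^ 2) := by congr 1; ring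
  have e6 : (s ^ (-(1 / 4 : ℝ)) + s ^ 2) ^ 2 ≤ 2 * (s ^ (-1 / 2 : ℝ) + s ^ 4) := by
    rw [← e1]
    nlinarith [sq_nonneg (s ^ (-(1 / 4 : ℝ)) - s ^ 2)]
  calc (1 + d / 2 + s ^ 2 / 4) * Real.exp (-s ^ 2 / 4) * (s ^ (-(1 / 4 : ℝ)) + s ^ 2) ^ 2
      ≤ (1 + d / 2 + s ^ 2 / 4) * Real.exp (-s ^ 2 / 4) * (2 * (s ^ (-1 / 2 : ℝ) + s ^ 4)) := by
        gcongr
    _ = _ := by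
        rw [e3, e4, ← e2, e5]
        ring

/-- The Laplace functional of `‖X t‖²` is `t * auxH` up to a quadratic error. -/
theorem exists_eventually_abs_integral_sub_auxH_le (hd : 1 ≤ d) (hX : ∀ t, Measurable (X t))
    (hψ : HasRadialCharExponent P X ψ) (hc : Continuous ψ) {l : Filter ℝ}
    (hl : ∀ᶠ x in l, 0 < x) (hpos : ∀ x, 0 < x → 0 < ψ x)
    (hP : ∃ K, ∀ᶠ x in l, ∀ u, 0 < u → u ≤ 1 → ψ (u * x) ≤ K * u ^ (-(1 / 4 : ℝ)) * ψ x) :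
    ∃ C, ∀ᶠ y in l, ∀ t : ℝ≥0,
      |(∫ ω, (1 - Real.exp (-(y ^ 2 * ‖X t ω‖ ^ 2)) * (1 + y ^ 2 * ‖X t ω‖ ^ 2)) ∂P) -
        t * auxH d ψ (y ^ 2)| ≤ C * (t ^ 2 * ψ y ^ 2) := by
  have hnn : ∀ s, 0 ≤ s → 0 ≤ ψ s := fun s hs => hψ.nonneg hX hd hs
  obtain ⟨K, hK0, hK⟩ := exists_eventually_le_potter_add_sq (by norm_num) hl hpos
    (fun s hs => hψ.doubling hX hd hs) hP
  set c : ℝ := (4 * Real.pi) ^ (-(d : ℝ) / 2)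
  have hc0 : 0 ≤ c := by positivity
  refine ⟨c * (K ^ 2 * ∫ ξ : EuclideanSpace ℝ (Fin d), (1 + d / 2 + ‖ξ‖ ^ 2 / 4) *
    Real.exp (-‖ξ‖ ^ 2 / 4) * (‖ξ‖ ^ (-(1 / 4 : ℝ)) + ‖ξ‖ ^ 2) ^ 2), ?_⟩
  filter_upwards [hl, hK] with y hy hyK t
  rw [integral_one_sub_exp_sub_auxH hd hX hψ hc t (by positivity), Real.sqrt_sq hy.le, abs_mul,
    abs_of_nonneg hc0, mul_assoc c]
  refine mul_le_mul_of_nonneg_left ?_ hc0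
  rw [mul_assoc (K ^ 2), mul_comm (K ^ 2), mul_assoc, ← integral_mul_const, ← Real.norm_eq_abs]
  refine norm_integral_le_of_norm_le ((integrable_weight_mul_potter_sq hd).mul_const _)
    (ae_of_all _ fun ξ => ?_)
  have hs : 0 ≤ ‖ξ‖ := norm_nonneg ξ
  have hψs := hnn (‖ξ‖ * y) (by positivity)
  have hψy := (hpos y hy).le
  have h1 : ψ (‖ξ‖ * y) ≤ K * (‖ξ‖ ^ (-(1 / 4 : ℝ)) + ‖ξ‖ ^ 2) * ψ y := by
    rcases hs.eq_or_lt with h | h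
    -- At `ξ = 0` the power `0 ^ (-1/4)` is `0` by convention, so the bound holds only because `ψ 0
    -- = 0`.
    · rw [← h, zero_mul, hψ.apply_zero hX]
      positivity
    · exact hyK _ h
  rw [norm_mul, norm_mul, Real.norm_of_nonneg (Real.exp_pos _).le, Real.norm_eq_abs,
    Real.norm_eq_abs]
  have h2 : |1 + (d : ℝ) / 2 - ‖ξ‖ ^ 2 / 4| ≤ 1 + d / 2 + ‖ξ‖ ^ 2 / 4 := by
    rw [abs_le]
    have : (0 : ℝ) ≤ d := d.cast_nonneg
    constructor <;> nlinarith [sq_nonneg ‖ξ‖]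
  have h3 := abs_one_sub_exp_neg_sub_le (y := t * ψ (‖ξ‖ * y)) (by positivity)
  calc _ ≤ (1 + d / 2 + ‖ξ‖ ^ 2 / 4) * Real.exp (-‖ξ‖ ^ 2 / 4) * (t * ψ (‖ξ‖ * y)) ^ 2 := by gcongr
    _ ≤ (1 + d / 2 + ‖ξ‖ ^ 2 / 4) * Real.exp (-‖ξ‖ ^ 2 / 4) *
        (t * (K * (‖ξ‖ ^ (-(1 / 4 : ℝ)) + ‖ξ‖ ^ 2) * ψ y)) ^ 2 := by gcongr
    _ = _ := by ring

/-- The tail asymptotics along an arbitrary filter of pairs `(t, r)`. -/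
theorem tendsto_tail_div_auxH (hd : 1 ≤ d) (hX : ∀ t, Measurable (X t))
    (hψ : HasRadialCharExponent P X ψ) (hc : Continuous ψ) {γ γ₁ : ℝ}
    (hγ : γ ∈ Set.Ico (0 : ℝ) 2) {l : Filter ℝ} (hl : ∀ᶠ x in l, 0 < x)
    (hscale : ∀ c : ℝ, 0 < c → Tendsto (fun x => c * x) l l)
    (hH : RegularlyVaries l (auxH d ψ) γ) (hψreg : RegularlyVaries l ψ γ₁)
    (hP : ∃ K, ∀ᶠ x in l, ∀ u, 0 < u → u ≤ 1 → ψ (u * x) ≤ K * u ^ (-(1 / 4 : ℝ)) * ψ x)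
    {F : Filter (ℝ≥0 × ℝ)} (hF : ∀ᶠ p in F, 0 < p.1 ∧ 0 < p.2)
    (hr : Tendsto (fun p : ℝ≥0 × ℝ => p.2⁻¹) F l)
    (hr2 : Tendsto (fun p : ℝ≥0 × ℝ => (p.2 ^ 2)⁻¹) F l)
    (hh : Tendsto (fun p : ℝ≥0 × ℝ => (p.1 : ℝ) * ψ p.2⁻¹ ^ 2 / auxH d ψ ((p.2 ^ 2)⁻¹)) F (𝓝 0)) :
    Tendsto (fun p : ℝ≥0 × ℝ => P.real {ω | p.2 ≤ ‖X p.1 ω‖} /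
      (1 / Real.Gamma (2 - γ) * (p.1 : ℝ) * auxH d ψ ((p.2 ^ 2)⁻¹))) F (𝓝 1) := by
  have hΓ : 0 < Real.Gamma (2 - γ) := Real.Gamma_pos_of_pos (by linarith [hγ.2])
  set N : ℝ≥0 × ℝ → ℝ := fun p => (p.1 : ℝ) * auxH d ψ ((p.2 ^ 2)⁻¹) with hN
  let Y : ℝ≥0 × ℝ → Ω → ℝ := fun p ω => (p.2 ^ 2)⁻¹ * ‖X p.1 ω‖ ^ 2
  have hYm : ∀ p, Measurable (Y p) := fun p => ((hX p.1).norm.pow_const 2).const_mul _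
  have hY0 : ∀ p ω, 0 ≤ Y p ω := fun p ω => by positivity
  set q : ℝ≥0 × ℝ → ℝ → ℝ := fun p u => P.real {ω | u ≤ Y p ω} / N p with hq
  have hNpos : ∀ᶠ p in F, 0 < N p := hF.mono fun p hp =>
    mul_pos (by exact_mod_cast hp.1) (hH.1 _ (by have := hp.2; positivity))
  have hlap : ∀ (p : ℝ≥0 × ℝ) (x : ℝ), 0 < x →
      IntegrableOn (fun u => Real.exp (-(x * u)) * u * q p u) (Set.Ioi 0) ∧
      ∫ u in Set.Ioi (0 : ℝ), Real.exp (-(x * u)) * u * q p u =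
        (x ^ 2)⁻¹ * (∫ ω, (1 - Real.exp (-(x * Y p ω)) * (1 + x * Y p ω)) ∂P) / N p := by
    intro p x hx
    have e : ∀ u : ℝ, Real.exp (-(x * u)) * u * q p u =
        Real.exp (-(x * u)) * u * P.real {ω | u ≤ Y p ω} / N p := fun u => by
      simp only [hq]; ring
    simp_rw [e]
    refine ⟨(integrableOn_mul_exp_neg_mul_tail hx).div_const _, ?_⟩
    rw [integral_div, integral_mul_exp_neg_mul_tail (hYm p) (hY0 p) hx]
  obtain ⟨C, hC⟩ := exists_eventually_abs_integral_sub_auxH_le hd hX hψ hc hl hψreg.1 hP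
  have hmain : Tendsto (fun p => q p 1) F (𝓝 (1 / Real.Gamma (2 - γ))) := by
    refine tendsto_one_of_tendsto_laplace (by linarith [hγ.2]) (by linarith [hγ.1]) ?_ ?_
    · filter_upwards [hNpos] with p hp
      refine ⟨fun u => div_nonneg measureReal_nonneg hp.le, fun a b hab => ?_, ?_⟩
      · exact div_le_div_of_nonneg_right (measureReal_mono fun ω (h : b ≤ Y p ω) => hab.trans h)
          hp.le
      · simpa using (hlap p 1 one_pos).1
    · intro x hx
      have hsx : 0 < √x := Real.sqrt_pos.2 hx
      have hlim1 : Tendsto (fun p : ℝ≥0 × ℝ => auxH d ψ (x * (p.2 ^ 2)⁻¹) /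
          auxH d ψ ((p.2 ^ 2)⁻¹)) F (𝓝 (x ^ γ)) := (hH.2 x hx).comp hr2
      -- The quadratic error at `y = √x / r`, divided by `tH(r⁻²)`: the vanishing quantity times a
      -- squared quotient of `ψ` that converges by regular variation.
      have hlim2 : Tendsto (fun p : ℝ≥0 × ℝ => C * (((p.1 : ℝ) * ψ p.2⁻¹ ^ 2 /
          auxH d ψ ((p.2 ^ 2)⁻¹)) * (ψ (√x * p.2⁻¹) / ψ p.2⁻¹) ^ 2)) F (𝓝 0) := by
        have := (hh.mul (((hψreg.2 (√x) hsx).comp hr).pow 2)).const_mul C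
        simpa using this
      have herr : Tendsto (fun p : ℝ≥0 × ℝ =>
          ((∫ ω, (1 - Real.exp (-(x * Y p ω)) * (1 + x * Y p ω)) ∂P) -
            p.1 * auxH d ψ (x * (p.2 ^ 2)⁻¹)) / N p) F (𝓝 0) := by
        refine squeeze_zero_norm' ?_ hlim2
        filter_upwards [hF, hNpos, ((hscale (√x) hsx).comp hr).eventually hC] with p hp hNp hCp
        have hr0 : 0 < p.2 := hp.2
        have ht0 : (0 : ℝ) < p.1 := by exact_mod_cast hp.1
        have hψr := hψreg.1 p.2⁻¹ (by positivity)
        have hHr := hH.1 (p.2 ^ 2)⁻¹ (by positivity)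
        have h1 := hCp p.1
        simp only [Function.comp_apply, mul_pow, Real.sq_sqrt hx.le, inv_pow, mul_assoc x] at h1
        rw [norm_div, Real.norm_of_nonneg hNp.le, Real.norm_eq_abs, div_le_iff₀ hNp]
        refine h1.trans (le_of_eq ?_)
        simp only [hN]
        generalize auxH d ψ (p.2 ^ 2)⁻¹ = b at hHr ⊢
        generalize ψ (√x * p.2⁻¹) = e
        generalize ψ p.2⁻¹ = a at hψr ⊢
        field_simp
      have hsum := (hlim1.add herr).const_mul (x ^ 2)⁻¹
      -- This fixes the Tauberian exponent as `β = 2 - γ`.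
      have hval : (x ^ 2)⁻¹ * (x ^ γ + 0) = x ^ (-(2 - γ)) := by
        rw [add_zero, neg_sub, Real.rpow_sub hx, Real.rpow_two, div_eq_inv_mul]
      rw [hval] at hsum
      refine hsum.congr' ?_
      filter_upwards [hF] with p hp
      have hr0 : 0 < p.2 := hp.2
      have ht0 : (0 : ℝ) < p.1 := by exact_mod_cast hp.1
      have hHr := hH.1 (p.2 ^ 2)⁻¹ (by positivity)
      rw [(hlap p x hx).2]
      simp only [hN]
      field_simp
      ring
  have := hmain.mul_const (Real.Gamma (2 - γ))
  rw [one_div_mul_cancel hΓ.ne'] at this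
  refine this.congr' ?_
  filter_upwards [hF] with p hp
  have hr0 : 0 < p.2 := hp.2
  have hset : {ω | 1 ≤ Y p ω} = {ω | p.2 ≤ ‖X p.1 ω‖} := by
    ext ω
    simp only [Y, Set.mem_ofPred_eq]
    rw [inv_mul_eq_div, one_le_div (by positivity), sq_le_sq₀ hr0.le (norm_nonneg _)]
  simp only [hq, hset, hN]
  field_simp

end Tail

/-! ### Reduction to an even exponent, and the two regimes -/

theorem auxPhi_comp_abs (d : ℕ) (ψ : ℝ → ℝ) : auxPhi d (fun s => ψ |s|) = auxPhi d ψ := by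
  funext x
  simp only [auxPhi]
  congr 2
  funext ξ
  rw [abs_of_nonneg (by positivity)]

theorem auxH_comp_abs (d : ℕ) (ψ : ℝ → ℝ) : auxH d (fun s => ψ |s|) = auxH d ψ := by
  funext x
  simp only [auxH, auxPhi_comp_abs]

theorem HasRadialCharExponent.comp_abs {Ω : Type*} [MeasurableSpace Ω] {P : Measure Ω} {d : ℕ}
    {X : ℝ≥0 → Ω → EuclideanSpace ℝ (Fin d)} {ψ : ℝ → ℝ} (hψ : HasRadialCharExponent P X ψ) :
    HasRadialCharExponent P X fun s => ψ |s| := by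
  intro t ξ
  rw [hψ t ξ]
  simp only [abs_norm]

theorem RegularlyVaries.comp_abs {l : Filter ℝ} {f : ℝ → ℝ} {α : ℝ} (h : RegularlyVaries l f α)
    (hl : ∀ᶠ x in l, 0 < x) : RegularlyVaries l (fun s => f |s|) α := by
  refine ⟨fun x hx => by simpa only [abs_of_pos hx] using h.1 x hx, fun c hc => ?_⟩
  refine (h.2 c hc).congr' ?_
  filter_upwards [hl] with x hx
  simp only [abs_of_pos hx, abs_of_pos (mul_pos hc hx)]

theorem tendsto_inv_sq_nhdsGT_zero : Tendsto (fun r : ℝ => (r ^ 2)⁻¹) (𝓝[>] 0) atTop := by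
  have := tendsto_inv_nhdsGT_zero (𝕜 := ℝ)
  simpa [Function.comp_def] using (tendsto_pow_atTop two_ne_zero).comp this

theorem tendsto_inv_sq_atTop : Tendsto (fun r : ℝ => (r ^ 2)⁻¹) atTop (𝓝[>] 0) :=
  tendsto_inv_atTop_nhdsGT_zero.comp (tendsto_pow_atTop two_ne_zero)

/-- Both regimes at once: `r` runs along `k`, while the arguments `r⁻¹` of `ψ` and `r⁻²` of `H` run
along `l`. Replacing `ψ` by `ψ |·|` changes none of the quantities and provides continuity on the
whole line. -/
theorem jointlyAsymptotic_tail {Ω : Type*} [MeasurableSpace Ω] {P : Measure Ω}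
    [IsProbabilityMeasure P] {d : ℕ} (hd : 1 ≤ d) {X : ℝ≥0 → Ω → EuclideanSpace ℝ (Fin d)}
    {ψ : ℝ → ℝ} (hX : ∀ t, Measurable (X t)) (hψ : HasRadialCharExponent P X ψ) {γ γ₁ : ℝ}
    (hγ : γ ∈ Set.Ico (0 : ℝ) 2) {l k : Filter ℝ} (hl : ∀ᶠ x in l, 0 < x)
    (hscale : ∀ c : ℝ, 0 < c → Tendsto (fun x => c * x) l l)
    (hH : RegularlyVaries l (auxH d ψ) γ) (hψreg : RegularlyVaries l ψ γ₁)
    (hP : ∃ K, ∀ᶠ x in l, ∀ u, 0 < u → u ≤ 1 →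
      ψ |u * x| ≤ K * u ^ (-(1 / 4 : ℝ)) * ψ |x|)
    (hk : Tendsto (fun r : ℝ => r⁻¹) k l) (hk2 : Tendsto (fun r : ℝ => (r ^ 2)⁻¹) k l) :
    JointlyAsymptotic k (fun t r => (t : ℝ) * ψ r⁻¹ ^ 2 / auxH d ψ ((r ^ 2)⁻¹))
      (fun t r => P.real {ω | r ≤ ‖X t ω‖})
      (fun t r => 1 / Real.Gamma (2 - γ) * (t : ℝ) * auxH d ψ ((r ^ 2)⁻¹)) := by
  set h : ℝ≥0 → ℝ → ℝ := fun t r => (t : ℝ) * ψ r⁻¹ ^ 2 / auxH d ψ ((r ^ 2)⁻¹)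
  have hF : ∀ᶠ p in jointLimit k h, 0 < p.1 ∧ 0 < p.2 :=
    (inf_le_right : jointLimit k h ≤ _) (mem_principal_self _)
  have hsnd : Tendsto Prod.snd (jointLimit k h) k :=
    tendsto_comap.mono_left (inf_le_left.trans inf_le_left)
  have hh : Tendsto (fun p : ℝ≥0 × ℝ => h p.1 p.2) (jointLimit k h) (𝓝 0) :=
    tendsto_comap.mono_left (inf_le_left.trans inf_le_right)
  have key := tendsto_tail_div_auxH hd hX hψ.comp_abs (hψ.continuous_comp_abs hX hd) hγ hl hscale
    (by rwa [auxH_comp_abs]) (hψreg.comp_abs hl) hP hF (hk.comp hsnd) (hk2.comp hsnd)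
    (hh.congr' (by
      filter_upwards [hF] with p hp
      simp only [h, auxH_comp_abs, abs_of_pos (inv_pos.2 hp.2)]))
  simp only [auxH_comp_abs] at key
  exact key

theorem mainTheorem5 {Ω : Type*} [MeasurableSpace Ω] (P : Measure Ω) [IsProbabilityMeasure P]
    (d : ℕ) (hd : 1 ≤ d) (X : ℝ≥0 → Ω → EuclideanSpace ℝ (Fin d)) (ψ : ℝ → ℝ)
    (hX : IsIsotropicLevyProcess P X) (hψ : HasRadialCharExponent P X ψ)
    (γ γ₁ : ℝ) (hγ : γ ∈ Set.Ico (0 : ℝ) 2) (hγ₁ : γ₁ ∈ Set.Icc (0 : ℝ) 2) :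
    (RegularlyVaries (𝓝[>] 0) (auxH d ψ) γ → RegularlyVaries (𝓝[>] 0) ψ γ₁ →
      JointlyAsymptotic atTop
        (fun t r => (t : ℝ) * ψ r⁻¹ ^ 2 / auxH d ψ ((r ^ 2)⁻¹))
        (fun t r => P.real {ω | r ≤ ‖X t ω‖})
        (fun t r => 1 / Real.Gamma (2 - γ) * (t : ℝ) * auxH d ψ ((r ^ 2)⁻¹))) ∧
    (RegularlyVaries atTop (auxH d ψ) γ → RegularlyVaries atTop ψ γ₁ →
      JointlyAsymptotic (𝓝[>] 0)
        (fun t r => (t : ℝ) * ψ r⁻¹ ^ 2 / auxH d ψ ((r ^ 2)⁻¹))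
        (fun t r => P.real {ω | r ≤ ‖X t ω‖})
        (fun t r => 1 / Real.Gamma (2 - γ) * (t : ℝ) * auxH d ψ ((r ^ 2)⁻¹))) := by
  have hmeas := hX.toIsLevyProcess.measurable
  have hc := hψ.continuous_comp_abs hmeas hd
  have h0 : ∀ᶠ x : ℝ in 𝓝[>] 0, 0 < x := self_mem_nhdsWithin
  have htop : ∀ᶠ x : ℝ in atTop, 0 < x := eventually_gt_atTop 0
  refine ⟨fun hH hreg => ?_, fun hH hreg => ?_⟩
  · exact jointlyAsymptotic_tail hd hmeas hψ hγ h0 (fun c hc => tendsto_const_mul_nhdsGT_zero hc)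
      hH hreg ((hreg.comp_abs h0).potter_zero hc.continuousOn hγ₁.1 (by norm_num))
      tendsto_inv_atTop_nhdsGT_zero tendsto_inv_sq_atTop
  · exact jointlyAsymptotic_tail hd hmeas hψ hγ htop (fun c hc => tendsto_id.const_mul_atTop hc)
      hH hreg ((hreg.comp_abs htop).potter_atTop hc.continuousOn hγ₁.1 (by norm_num))
      tendsto_inv_nhdsGT_zero tendsto_inv_sq_nhdsGT_zero
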